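/- Fix integers $n,l,q,m_1,m_2\ge 0$, a horizon $K\in\mathbb N$, $N_K=\{0,1,\dots,K\}$, and a level $\gamma>0$. Let $\omega(0),\dots,\omega(K)$ be square-integrable real random variables on a probability space with $\mathbf E\,\omega(s)=0$, $\mathbf E[\omega(s)\omega(t)]=\delta_{st}$, and $\omega(k)$ independent of $\mathcal F_{k-1}=\sigma(\omega(0),\dots,\omega(k-1))$ for each $k\in N_K$ ($\mathcal F_{-1}$ is trivial). Let $l^2_\omega(N_K,\mathbb R^p)$ be the set of sequences $(y(k))_{k\in N_K}$ of square-integrable $\mathbb R^p$-valued random vectors with $y(k)$ $\mathcal F_{k-1}$-measurable, and $\|y\|^2=\sum_{k=0}^K\mathbf E\|y(k)\|^2$ (Euclidean norm on $\mathbb R^p$). Consider the mean-field system, with deterministic $x(0)=x_0\in\mathbb R^n$ and deterministic real coefficient matrices of compatible sizes, $$x(k+1)=A(k)x(k)+\widetilde A(k)\mathbf Ex(k)+B(k)\nu(k)+\widetilde B(k)\mathbf E\nu(k)+\big[C(k)x(k)+\widetilde C(k)\mathbf Ex(k)+D(k)\nu(k)+\widetilde D(k)\mathbf E\nu(k)\big]\omega(k)+F_1(k)u(k),$$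 $$z(k)=\begin{bmatrix}\Phi(k)x(k)\\ \Psi(k)u(k)\end{bmatrix},\qquad \Psi(k)^T\Psi(k)=I_q,\qquad k\in N_K,$$ with state in $\mathbb R^n$, disturbance $\nu\in l^2_\omega(N_K,\mathbb R^l)$, control $u\in l^2_\omega(N_K,\mathbb R^q)$, $\Phi(k)\in\mathbb R^{m_1\times n}$, $\Psi(k)\in\mathbb R^{m_2\times q}$. Write $\mathbb A=A+\widetilde A$, $\mathbb B=B+\widetilde B$, $\mathbb C=C+\widetilde C$, $\mathbb D=D+\widetilde D$, $\mathbb U=U+\widetilde U$, $\mathbb V=V+\widetilde V$. Suppose that real matrices $P_1(k),Q_1(k),\widetilde P_1(k),\widetilde Q_1(k)\in\mathbb R^{n\times n}$ ($0\le k\le K+1$), $U(k),\widetilde U(k)\in\mathbb R^{q\times n}$ and $V(k),\widetilde V(k)\in\mathbb R^{l\times n}$ ($k\in N_K$) satisfy $P_1(K+1)=Q_1(K+1)=\widetilde P_1(K+1)=\widetilde Q_1(K+1)=0$ and the following equations for every $k\in N_K$. The coefficients, $U,\widetilde U,V,\widetilde V$, and their sums are taken at time $k$, and we abbreviate $P^+=P_1(k+1)$,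 $Q^+=Q_1(k+1)$, $\widetilde P^+=\widetilde P_1(k+1)$, $\widetilde Q^+=\widetilde Q_1(k+1)$: $$P_1(k)=(A+F_1U)^TP^+(A+F_1U)+C^TP^+C-\Phi^T\Phi-U^TU-G_uH^{-1}G_u^T,$$ $$Q_1(k)=(\mathbb A+F_1\mathbb U)^TQ^+(\mathbb A+F_1\mathbb U)+\mathbb C^TP^+\mathbb C-\Phi^T\Phi-\mathbb U^T\mathbb U-\widetilde G_u\widetilde H^{-1}\widetilde G_u^T,$$ $$V=-H^{-1}G_u^T,\qquad \mathbb V=-\widetilde H^{-1}\widetilde G_u^T,$$ $$\widetilde P_1(k)=(A+BV)^T\widetilde P^+(A+BV)+(C+DV)^T\widetilde P^+(C+DV)+\Phi^T\Phi-G_\nu H_1^{-1}G_\nu^T,$$ $$\widetilde Q_1(k)=(\mathbb A+\mathbb B\mathbb V)^T\widetilde Q^+(\mathbb A+\mathbb B\mathbb V)+(\mathbb C+\mathbb D\mathbb V)^T\widetilde P^+(\mathbb C+\mathbb D\mathbb V)+\Phi^T\Phi-\widetilde G_\nu\widetilde H_1^{-1}\widetilde G_\nu^T,$$ $$U=-H_1^{-1}G_\nu^T,\qquad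 \mathbb U=-\widetilde H_1^{-1}\widetilde G_\nu^T,$$ where $$H=\gamma^2I_l+B^TP^+B+D^TP^+D,\quad \widetilde H=\gamma^2I_l+\mathbb B^TQ^+\mathbb B+\mathbb D^TP^+\mathbb D,\quad H_1=I_q+F_1^T\widetilde P^+F_1,\quad \widetilde H_1=I_q+F_1^T\widetilde Q^+F_1$$ are all symmetric positive definite, and $$G_u=(A+F_1U)^TP^+B+C^TP^+D,\qquad \widetilde G_u=(\mathbb A+F_1\mathbb U)^TQ^+\mathbb B+\mathbb C^TP^+\mathbb D,$$ $$G_\nu=(A+BV)^T\widetilde P^+F_1,\qquad \widetilde G_\nu=(\mathbb A+\mathbb B\mathbb V)^T\widetilde Q^+F_1.$$ Then $Q_1(k)\le 0$ and $\widetilde Q_1(k)\ge 0$ (symmetric negative, respectively positive, semidefinite) for all $k\in N_K$, and the feedbacks $u^*(k)=U(k)x(k)+\widetilde U(k)\mathbf Ex(k)$ and $\nu^*(k)=V(k)x(k)+\widetilde V(k)\mathbf Ex(k)$ solve the finite-horizon mean-field $H_2/H_\infty$ control problem, that is: 1. For every $x_0$, under $u^*$ with any $\nu\in l^2_\omega(N_K,\mathbb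 R^l)$, under any $u\in l^2_\omega(N_K,\mathbb R^q)$ with $\nu^*$, and under $u^*$ with $\nu^*$, the state $x$, the input signals and the output $z$ belong to the respective $l^2_\omega$ spaces. 2. For the closed loop under $u^*$ with $x_0=0$, $\displaystyle\|L_K\|=\sup_{0\ne\nu\in l^2_\omega(N_K,\mathbb R^l)}\frac{\|z\|}{\|\nu\|}<\gamma$. 3. $\nu^*$ is a worst-case disturbance for $u^*$: for every $x_0$ and every $\nu\in l^2_\omega(N_K,\mathbb R^l)$, $J_1^K(u^*,\nu^*)\le J_1^K(u^*,\nu)$, where $J_1^K(u,\nu)=\sum_{k=0}^K\mathbf E[\gamma^2\|\nu(k)\|^2-\|z(k)\|^2]$. 4. When the feedback $\nu^*$ is implemented in the system, $u^*$ minimizes the output energy: for every $x_0$ and every $u\in l^2_\omega(N_K,\mathbb R^q)$, $J_2^K(u^*,\nu^*)\le J_2^K(u,\nu^*)$, where $J_2^K(u,\nu)=\|z\|^2$. -/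

import Mathlib

open MeasureTheory ProbabilityTheory Matrix
open scoped ENNReal

/-- Coefficients of the controlled mean-field system
`x(k+1) = A x + Ã 𝔼x + B ν + B̃ 𝔼ν + [C x + C̃ 𝔼x + D ν + D̃ 𝔼ν] ω(k) + F u`,
`z = (Φ x, Ψ u)`.  The names with a final `t` are the coefficients with a tilde. -/
structure MFSystem (n l q m₁ m₂ : ℕ) where
  A : ℕ → Matrix (Fin n) (Fin n) ℝ
  At : ℕ → Matrix (Fin n) (Fin n) ℝ
  B : ℕ → Matrix (Fin n) (Fin l) ℝ
  Bt : ℕ → Matrix (Fin n) (Fin l) ℝ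
  C : ℕ → Matrix (Fin n) (Fin n) ℝ
  Ct : ℕ → Matrix (Fin n) (Fin n) ℝ
  D : ℕ → Matrix (Fin n) (Fin l) ℝ
  Dt : ℕ → Matrix (Fin n) (Fin l) ℝ
  F : ℕ → Matrix (Fin n) (Fin q) ℝ
  Φ : ℕ → Matrix (Fin m₁) (Fin n) ℝ
  Ψ : ℕ → Matrix (Fin m₂) (Fin q) ℝ

section Noise

variable {Ω : Type*} [MeasurableSpace Ω]

/-- The σ-algebra `𝓕_{k-1} = σ(ω(0), …, ω(k-1))`; it is trivial for `k = 0`. -/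
@[reducible] def pastSigma (w : ℕ → Ω → ℝ) (k : ℕ) : MeasurableSpace Ω :=
  ⨆ (j : ℕ) (_ : j < k), MeasurableSpace.comap (w j) inferInstance

/-- The noise `ω(0), …, ω(K)`: square integrable real random variables with `𝔼 ω(s) = 0`,
`𝔼 [ω(s) ω(t)] = δ_{st}`, and `ω(k)` independent of the past `ω(0), …, ω(k-1)`. -/
structure IsNoise (μ : Measure Ω) (K : ℕ) (w : ℕ → Ω → ℝ) : Prop where
  measurable : ∀ k ≤ K, Measurable (w k)
  memLp : ∀ k ≤ K, MemLp (w k) 2 μ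
  mean : ∀ k ≤ K, ∫ a, w k a ∂μ = 0
  cov : ∀ s ≤ K, ∀ t ≤ K, ∫ a, w s a * w t a ∂μ = if s = t then 1 else 0
  indep : ∀ k ≤ K, Indep (MeasurableSpace.comap (w k) inferInstance) (pastSigma w k) μ

/-- The space `l²_ω(N_K, ℝ^ι)`: `y(k)` is square integrable and `𝓕_{k-1}`-measurable for
`k = 0, …, K`.  (Square integrability does not depend on the norm chosen on `ι → ℝ`.) -/
def MemL2w {ι : Type*} [Fintype ι] (μ : Measure Ω) (K : ℕ) (w : ℕ → Ω → ℝ)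
    (y : ℕ → Ω → ι → ℝ) : Prop :=
  ∀ k ≤ K, Measurable[pastSigma w k] (y k) ∧ MemLp (y k) 2 μ

/-- The squared `l²_ω` norm `∑_{k=0}^K 𝔼 ‖y(k)‖²`, with the Euclidean norm `‖v‖² = v ⬝ᵥ v`. -/
noncomputable def energy {ι : Type*} [Fintype ι] (μ : Measure Ω) (K : ℕ)
    (y : ℕ → Ω → ι → ℝ) : ℝ :=
  ∑ k ∈ Finset.range (K + 1), ∫ a, y k a ⬝ᵥ y k a ∂μ

end Noise

/-- A rule that produces, at time `k`, an `ℝ^p`-valued random input from the current random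
state. -/
abbrev Policy (Ω : Type*) (n p : ℕ) := ℕ → (Ω → Fin n → ℝ) → Ω → Fin p → ℝ

/-- A prescribed input process, independent of the state. -/
def openLoop {Ω : Type*} {n p : ℕ} (y : ℕ → Ω → Fin p → ℝ) : Policy Ω n p :=
  fun k _ => y k

section Dynamics

variable {Ω : Type*} [MeasurableSpace Ω] {n l q m₁ m₂ : ℕ}

/-- The mean-field state feedback `U(k) x(k) + Ũ(k) 𝔼x(k)`. -/
noncomputable def feedback {p : ℕ} (μ : Measure Ω) (U Ut : ℕ → Matrix (Fin p) (Fin n) ℝ) :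
    Policy Ω n p :=
  fun k x a => U k *ᵥ x a + Ut k *ᵥ ∫ b, x b ∂μ

/-- One step of the state equation at time `k`, with state `x`, control `u`, disturbance `v`. -/
noncomputable def MFSystem.step (S : MFSystem n l q m₁ m₂) (μ : Measure Ω) (w : ℕ → Ω → ℝ)
    (k : ℕ) (x : Ω → Fin n → ℝ) (u : Ω → Fin q → ℝ) (v : Ω → Fin l → ℝ) : Ω → Fin n → ℝ :=
  fun a =>
    S.A k *ᵥ x a + S.At k *ᵥ (∫ b, x b ∂μ) + S.B k *ᵥ v a + S.Bt k *ᵥ (∫ b, v b ∂μ)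
      + w k a • (S.C k *ᵥ x a + S.Ct k *ᵥ (∫ b, x b ∂μ)
          + S.D k *ᵥ v a + S.Dt k *ᵥ (∫ b, v b ∂μ))
      + S.F k *ᵥ u a

/-- The state process started at the deterministic vector `x₀`, when the control is generated
by `c` and the disturbance by `d`. -/
noncomputable def MFSystem.state (S : MFSystem n l q m₁ m₂) (μ : Measure Ω) (w : ℕ → Ω → ℝ)
    (x₀ : Fin n → ℝ) (c : Policy Ω n q) (d : Policy Ω n l) : ℕ → Ω → Fin n → ℝ
  | 0 => fun _ => x₀
  | k + 1 =>
      S.step μ w k (S.state μ w x₀ c d k) (c k (S.state μ w x₀ c d k))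
        (d k (S.state μ w x₀ c d k))

/-- The control process generated by `c` along the trajectory. -/
noncomputable def MFSystem.control (S : MFSystem n l q m₁ m₂) (μ : Measure Ω) (w : ℕ → Ω → ℝ)
    (x₀ : Fin n → ℝ) (c : Policy Ω n q) (d : Policy Ω n l) : ℕ → Ω → Fin q → ℝ :=
  fun k => c k (S.state μ w x₀ c d k)

/-- The disturbance process generated by `d` along the trajectory. -/
noncomputable def MFSystem.disturbance (S : MFSystem n l q m₁ m₂) (μ : Measure Ω)
    (w : ℕ → Ω → ℝ) (x₀ : Fin n → ℝ) (c : Policy Ω n q) (d : Policy Ω n l) :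
    ℕ → Ω → Fin l → ℝ :=
  fun k => d k (S.state μ w x₀ c d k)

/-- The controlled output `z(k) = (Φ(k) x(k), Ψ(k) u(k))`. -/
noncomputable def MFSystem.output (S : MFSystem n l q m₁ m₂) (μ : Measure Ω) (w : ℕ → Ω → ℝ)
    (x₀ : Fin n → ℝ) (c : Policy Ω n q) (d : Policy Ω n l) : ℕ → Ω → Fin m₁ ⊕ Fin m₂ → ℝ :=
  fun k a => Sum.elim (S.Φ k *ᵥ S.state μ w x₀ c d k a) (S.Ψ k *ᵥ S.control μ w x₀ c d k a)

/-- `J₁ = ∑_{k=0}^K 𝔼 [γ² ‖ν(k)‖² - ‖z(k)‖²]`. -/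
noncomputable def MFSystem.J₁ (S : MFSystem n l q m₁ m₂) (μ : Measure Ω) (w : ℕ → Ω → ℝ)
    (K : ℕ) (γ : ℝ) (x₀ : Fin n → ℝ) (c : Policy Ω n q) (d : Policy Ω n l) : ℝ :=
  γ ^ 2 * energy μ K (S.disturbance μ w x₀ c d) - energy μ K (S.output μ w x₀ c d)

/-- The output energy `J₂ = ‖z‖²` in `l²_ω`. -/
noncomputable def MFSystem.J₂ (S : MFSystem n l q m₁ m₂) (μ : Measure Ω) (w : ℕ → Ω → ℝ)
    (K : ℕ) (x₀ : Fin n → ℝ) (c : Policy Ω n q) (d : Policy Ω n l) : ℝ :=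
  energy μ K (S.output μ w x₀ c d)

/-- The norm `‖L_K‖` of the perturbation operator `ν ↦ z` under the control `c`: the supremum
of `‖z‖ / ‖ν‖` over all `ν ≠ 0` in `l²_ω`, for `x₀ = 0`, as an extended nonnegative real. -/
noncomputable def MFSystem.normL (S : MFSystem n l q m₁ m₂) (μ : Measure Ω) (w : ℕ → Ω → ℝ)
    (K : ℕ) (c : Policy Ω n q) : ℝ≥0∞ :=
  ⨆ (ν : ℕ → Ω → Fin l → ℝ) (_ : MemL2w μ K w ν ∧ energy μ K ν ≠ 0),
    ENNReal.ofReal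
      (√(energy μ K (S.output μ w 0 c (openLoop ν))) / √(energy μ K ν))

/-- The feedback pair `u* = U x + Ũ 𝔼x`, `ν* = V x + Ṽ 𝔼x` solves the finite-horizon
mean-field `H₂/H∞` control problem with attenuation level `γ`. -/
structure MFSystem.SolvesH2Hinf (S : MFSystem n l q m₁ m₂) (μ : Measure Ω) (w : ℕ → Ω → ℝ)
    (K : ℕ) (γ : ℝ) (U Ut : ℕ → Matrix (Fin q) (Fin n) ℝ)
    (V Vt : ℕ → Matrix (Fin l) (Fin n) ℝ) : Prop where
  /-- Under `u*` and any disturbance in `l²_ω`, all signals are in `l²_ω`. -/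
  closedLoop_mem : ∀ (x₀ : Fin n → ℝ) (ν : ℕ → Ω → Fin l → ℝ), MemL2w μ K w ν →
    MemL2w μ K w (S.state μ w x₀ (feedback μ U Ut) (openLoop ν)) ∧
    MemL2w μ K w (S.control μ w x₀ (feedback μ U Ut) (openLoop ν)) ∧
    MemL2w μ K w (S.output μ w x₀ (feedback μ U Ut) (openLoop ν))
  /-- When `ν*` is implemented, with any control in `l²_ω`, all signals are in `l²_ω`. -/
  disturbed_mem : ∀ (x₀ : Fin n → ℝ) (u : ℕ → Ω → Fin q → ℝ), MemL2w μ K w u →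
    MemL2w μ K w (S.state μ w x₀ (openLoop u) (feedback μ V Vt)) ∧
    MemL2w μ K w (S.disturbance μ w x₀ (openLoop u) (feedback μ V Vt)) ∧
    MemL2w μ K w (S.output μ w x₀ (openLoop u) (feedback μ V Vt))
  /-- Under `u*` and `ν*` together, all signals are in `l²_ω`. -/
  pair_mem : ∀ x₀ : Fin n → ℝ,
    MemL2w μ K w (S.state μ w x₀ (feedback μ U Ut) (feedback μ V Vt)) ∧
    MemL2w μ K w (S.control μ w x₀ (feedback μ U Ut) (feedback μ V Vt)) ∧
    MemL2w μ K w (S.disturbance μ w x₀ (feedback μ U Ut) (feedback μ V Vt)) ∧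
    MemL2w μ K w (S.output μ w x₀ (feedback μ U Ut) (feedback μ V Vt))
  /-- The closed loop under `u*` satisfies `‖L_K‖ < γ`. -/
  attenuation : S.normL μ w K (feedback μ U Ut) < ENNReal.ofReal γ
  /-- `ν*` is a worst-case disturbance for `u*`: it minimizes `J₁(u*, ·)` over `l²_ω`. -/
  worst_case : ∀ (x₀ : Fin n → ℝ) (ν : ℕ → Ω → Fin l → ℝ), MemL2w μ K w ν →
    S.J₁ μ w K γ x₀ (feedback μ U Ut) (feedback μ V Vt) ≤
      S.J₁ μ w K γ x₀ (feedback μ U Ut) (openLoop ν)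
  /-- When `ν*` is implemented, `u*` minimizes the output energy over `l²_ω`. -/
  optimal : ∀ (x₀ : Fin n → ℝ) (u : ℕ → Ω → Fin q → ℝ), MemL2w μ K w u →
    S.J₂ μ w K x₀ (feedback μ U Ut) (feedback μ V Vt) ≤
      S.J₂ μ w K x₀ (openLoop u) (feedback μ V Vt)

end Dynamics

section Equations

variable {n l q m₁ m₂ : ℕ} (S : MFSystem n l q m₁ m₂)

/-- `H(P) = γ² I + Bᵀ P B + Dᵀ P D` at time `k`. -/
def MFSystem.H (γ : ℝ) (k : ℕ) (P : Matrix (Fin n) (Fin n) ℝ) : Matrix (Fin l) (Fin l) ℝ :=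
  γ ^ 2 • (1 : Matrix (Fin l) (Fin l) ℝ) + (S.B k)ᵀ * P * S.B k + (S.D k)ᵀ * P * S.D k

/-- `H̃(P, Q) = γ² I + (B + B̃)ᵀ Q (B + B̃) + (D + D̃)ᵀ P (D + D̃)` at time `k`. -/
def MFSystem.Ht (γ : ℝ) (k : ℕ) (P Q : Matrix (Fin n) (Fin n) ℝ) :
    Matrix (Fin l) (Fin l) ℝ :=
  γ ^ 2 • (1 : Matrix (Fin l) (Fin l) ℝ) + (S.B k + S.Bt k)ᵀ * Q * (S.B k + S.Bt k)
    + (S.D k + S.Dt k)ᵀ * P * (S.D k + S.Dt k)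

/-- `H₁(P) = I + Fᵀ P F` and likewise `H̃₁(P, Q) = I + Fᵀ Q F` at time `k`. -/
def MFSystem.H₁ (k : ℕ) (P : Matrix (Fin n) (Fin n) ℝ) : Matrix (Fin q) (Fin q) ℝ :=
  1 + (S.F k)ᵀ * P * S.F k

/-- `G_u(P) = (A + F U)ᵀ P B + Cᵀ P D` at time `k`. -/
def MFSystem.Gu (k : ℕ) (U : Matrix (Fin q) (Fin n) ℝ) (P : Matrix (Fin n) (Fin n) ℝ) :
    Matrix (Fin n) (Fin l) ℝ :=
  (S.A k + S.F k * U)ᵀ * P * S.B k + (S.C k)ᵀ * P * S.D k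

/-- `G̃_u(P, Q) = (A + Ã + F 𝕌)ᵀ Q (B + B̃) + (C + C̃)ᵀ P (D + D̃)` at time `k`. -/
def MFSystem.Gut (k : ℕ) (UU : Matrix (Fin q) (Fin n) ℝ) (P Q : Matrix (Fin n) (Fin n) ℝ) :
    Matrix (Fin n) (Fin l) ℝ :=
  (S.A k + S.At k + S.F k * UU)ᵀ * Q * (S.B k + S.Bt k)
    + (S.C k + S.Ct k)ᵀ * P * (S.D k + S.Dt k)

/-- `G_ν(P̃) = (A + B V)ᵀ P̃ F` at time `k`. -/
def MFSystem.Gv (k : ℕ) (V : Matrix (Fin l) (Fin n) ℝ) (P : Matrix (Fin n) (Fin n) ℝ) :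
    Matrix (Fin n) (Fin q) ℝ :=
  (S.A k + S.B k * V)ᵀ * P * S.F k

/-- `G̃_ν(P̃, Q̃) = (A + Ã + (B + B̃) 𝕍)ᵀ Q̃ F` at time `k`. -/
def MFSystem.Gvt (k : ℕ) (VV : Matrix (Fin l) (Fin n) ℝ) (Q : Matrix (Fin n) (Fin n) ℝ) :
    Matrix (Fin n) (Fin q) ℝ :=
  (S.A k + S.At k + (S.B k + S.Bt k) * VV)ᵀ * Q * S.F k

/-- `(P, Q; Pt, Qt; U, Ut; V, Vt)`, standing for `(P₁, Q₁; P̃₁, Q̃₁; U, Ũ; V, Ṽ)`, solves the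
four coupled matrix-valued backward equations on the horizon `k = 0, …, K`. -/
structure MFSystem.SolvesCoupled (γ : ℝ) (K : ℕ) (P Q Pt Qt : ℕ → Matrix (Fin n) (Fin n) ℝ)
    (U Ut : ℕ → Matrix (Fin q) (Fin n) ℝ) (V Vt : ℕ → Matrix (Fin l) (Fin n) ℝ) : Prop where
  eq_P : ∀ k ≤ K, P k =
    (S.A k + S.F k * U k)ᵀ * P (k + 1) * (S.A k + S.F k * U k)
      + (S.C k)ᵀ * P (k + 1) * S.C k - (S.Φ k)ᵀ * S.Φ k - (U k)ᵀ * U k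
      - S.Gu k (U k) (P (k + 1)) * (S.H γ k (P (k + 1)))⁻¹ * (S.Gu k (U k) (P (k + 1)))ᵀ
  eq_Q : ∀ k ≤ K, Q k =
    (S.A k + S.At k + S.F k * (U k + Ut k))ᵀ * Q (k + 1)
        * (S.A k + S.At k + S.F k * (U k + Ut k))
      + (S.C k + S.Ct k)ᵀ * P (k + 1) * (S.C k + S.Ct k) - (S.Φ k)ᵀ * S.Φ k
      - (U k + Ut k)ᵀ * (U k + Ut k)
      - S.Gut k (U k + Ut k) (P (k + 1)) (Q (k + 1)) * (S.Ht γ k (P (k + 1)) (Q (k + 1)))⁻¹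
        * (S.Gut k (U k + Ut k) (P (k + 1)) (Q (k + 1)))ᵀ
  final_P : P (K + 1) = 0
  final_Q : Q (K + 1) = 0
  pos_H : ∀ k ≤ K, (S.H γ k (P (k + 1))).PosDef
  pos_Ht : ∀ k ≤ K, (S.Ht γ k (P (k + 1)) (Q (k + 1))).PosDef
  eq_V : ∀ k ≤ K, V k =
    -((S.H γ k (P (k + 1)))⁻¹ * (S.Gu k (U k) (P (k + 1)))ᵀ)
  eq_Vt : ∀ k ≤ K, V k + Vt k =
    -((S.Ht γ k (P (k + 1)) (Q (k + 1)))⁻¹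
      * (S.Gut k (U k + Ut k) (P (k + 1)) (Q (k + 1)))ᵀ)
  eq_Pt : ∀ k ≤ K, Pt k =
    (S.A k + S.B k * V k)ᵀ * Pt (k + 1) * (S.A k + S.B k * V k)
      + (S.C k + S.D k * V k)ᵀ * Pt (k + 1) * (S.C k + S.D k * V k) + (S.Φ k)ᵀ * S.Φ k
      - S.Gv k (V k) (Pt (k + 1)) * (S.H₁ k (Pt (k + 1)))⁻¹ * (S.Gv k (V k) (Pt (k + 1)))ᵀ
  eq_Qt : ∀ k ≤ K, Qt k =
    (S.A k + S.At k + (S.B k + S.Bt k) * (V k + Vt k))ᵀ * Qt (k + 1)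
        * (S.A k + S.At k + (S.B k + S.Bt k) * (V k + Vt k))
      + (S.C k + S.Ct k + (S.D k + S.Dt k) * (V k + Vt k))ᵀ * Pt (k + 1)
        * (S.C k + S.Ct k + (S.D k + S.Dt k) * (V k + Vt k))
      + (S.Φ k)ᵀ * S.Φ k
      - S.Gvt k (V k + Vt k) (Qt (k + 1)) * (S.H₁ k (Qt (k + 1)))⁻¹
        * (S.Gvt k (V k + Vt k) (Qt (k + 1)))ᵀ
  final_Pt : Pt (K + 1) = 0
  final_Qt : Qt (K + 1) = 0
  pos_H₁ : ∀ k ≤ K, (S.H₁ k (Pt (k + 1))).PosDef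
  pos_H₁t : ∀ k ≤ K, (S.H₁ k (Qt (k + 1))).PosDef
  eq_U : ∀ k ≤ K, U k = -((S.H₁ k (Pt (k + 1)))⁻¹ * (S.Gv k (V k) (Pt (k + 1)))ᵀ)
  eq_Ut : ∀ k ≤ K, U k + Ut k =
    -((S.H₁ k (Qt (k + 1)))⁻¹ * (S.Gvt k (V k + Vt k) (Qt (k + 1)))ᵀ)

end Equations

/-! Once one player is held to its feedback, the other faces a mean-field linear-quadratic problem,
and this splits in two. Centring removes the mean terms, so the drift of `x - 𝔼x` uses the plain
coefficients and that of `𝔼x` the summed ones. Noise that is independent of the past, with mean zero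
and unit variance, leaves the mean alone and adds the second moment of its intensity to the
covariance. The form `𝔼 (x - 𝔼x)ᵀ P (x - 𝔼x) + (𝔼x)ᵀ Q 𝔼x` is therefore propagated by two
deterministic quadratic expressions, with `P` weighting the diffusion in both
(`meanFieldForm_add_noise`).

Each backward equation completes the square in one of these expressions (`stage_completion`, lifted
by `meanField_stage`). Telescoping with zero terminal values gives `J₁_eq`: under `u*`, `γ²‖ν‖² -
‖z‖²` is `x₀ᵀ Q(0) x₀` plus a sum of nonnegative forms in `ν - ν*`. Likewise `J₂_eq`: under `ν*`,
`‖z‖²` is `x₀ᵀ Qt(0) x₀` plus such a sum in `u - u*`. The residuals vanish for the feedback pair,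
which proves both optimality claims.

Nonnegativity alone would only give `‖L_K‖ ≤ γ`. For strictness, take `x₀ = 0`: the disturbance can
be reconstructed from the residuals `ν - ν*` by running the system, with uniform bounds on a finite
horizon. Hence `‖ν‖²` is at most `M` times the sum of the residual forms (`exists_energy_bound`),
and `‖z‖² ≤ (γ² - 1/M) ‖ν‖²`.

The signs of the value matrices follow by backward induction, which also supplies the symmetry
needed to complete the squares. -/

section SecondMoments

/-! ### Mean-field second moments and independent multiplicative noise. -/

variable {Ω ι κ : Type*} [MeasurableSpace Ω] [Fintype ι] [Fintype κ]

/-- The second moment `𝔼 yᵀ P y`. -/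
noncomputable def secondMoment (μ : Measure Ω) (P : Matrix ι ι ℝ) (y : Ω → ι → ℝ) : ℝ :=
  ∫ a, y a ⬝ᵥ P *ᵥ y a ∂μ

/-- The centred random vector `y - 𝔼y`. -/
noncomputable def centred (μ : Measure Ω) (y : Ω → ι → ℝ) : Ω → ι → ℝ :=
  fun a => y a - ∫ b, y b ∂μ

/-- The mean-field quadratic form `𝔼 (y - 𝔼y)ᵀ P (y - 𝔼y) + (𝔼y)ᵀ Q (𝔼y)`. -/
noncomputable def meanFieldForm (μ : Measure Ω) (P Q : Matrix ι ι ℝ) (y : Ω → ι → ℝ) : ℝ :=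
  secondMoment μ P (centred μ y) + (∫ b, y b ∂μ) ⬝ᵥ Q *ᵥ ∫ b, y b ∂μ

/-- The mean-field linear map `y ↦ M y + M̃ 𝔼y`. -/
noncomputable def meanFieldMap (μ : Measure Ω) (M Mt : Matrix κ ι ℝ) (y : Ω → ι → ℝ) :
    Ω → κ → ℝ :=
  fun a => M *ᵥ y a + Mt *ᵥ ∫ b, y b ∂μ

theorem MeasureTheory.MemLp.mulVec {μ : Measure Ω} {p : ℝ≥0∞} {y : Ω → ι → ℝ}
    (hy : MemLp y p μ) (M : Matrix κ ι ℝ) : MemLp (fun a => M *ᵥ y a) p μ :=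
  (LinearMap.toContinuousLinearMap M.mulVecLin).comp_memLp' hy

theorem integral_mulVec {μ : Measure Ω} {y : Ω → ι → ℝ} (hy : Integrable y μ)
    (M : Matrix κ ι ℝ) : ∫ a, M *ᵥ y a ∂μ = M *ᵥ ∫ a, y a ∂μ :=
  (LinearMap.toContinuousLinearMap M.mulVecLin).integral_comp_comm hy

theorem integrable_dotProduct {μ : Measure Ω} {x y : Ω → ι → ℝ} (hx : MemLp x 2 μ)
    (hy : MemLp y 2 μ) : Integrable (fun a => x a ⬝ᵥ y a) μ := by
  simp only [dotProduct]
  refine integrable_finsetSum _ fun i _ => ?_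
  exact (((ContinuousLinearMap.proj (R := ℝ) (φ := fun _ : ι => ℝ) i).comp_memLp' hx).integrable_mul
    ((ContinuousLinearMap.proj (R := ℝ) (φ := fun _ : ι => ℝ) i).comp_memLp' hy))

theorem integrable_quadratic {μ : Measure Ω} {y : Ω → ι → ℝ} (hy : MemLp y 2 μ)
    (P : Matrix ι ι ℝ) : Integrable (fun a => y a ⬝ᵥ P *ᵥ y a) μ :=
  integrable_dotProduct hy (hy.mulVec P)

theorem integral_dotProduct_const {μ : Measure Ω} {y : Ω → ι → ℝ} (hy : Integrable y μ)
    (c : ι → ℝ) : ∫ a, y a ⬝ᵥ c ∂μ = (∫ a, y a ∂μ) ⬝ᵥ c := by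
  have h := (LinearMap.toContinuousLinearMap
    ({ toFun := fun v : ι → ℝ => v ⬝ᵥ c
       map_add' := fun v v' => add_dotProduct v v' c
       map_smul' := fun r v => smul_dotProduct r v c } : (ι → ℝ) →ₗ[ℝ] ℝ)).integral_comp_comm hy
  exact h

variable {μ : Measure Ω} [IsProbabilityMeasure μ]

theorem memLp_centred {y : Ω → ι → ℝ} (hy : MemLp y 2 μ) : MemLp (centred μ y) 2 μ :=
  hy.sub (memLp_const _)

theorem memLp_meanFieldMap {y : Ω → ι → ℝ} (hy : MemLp y 2 μ) (M Mt : Matrix κ ι ℝ) :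
    MemLp (meanFieldMap μ M Mt y) 2 μ :=
  (hy.mulVec M).add (memLp_const _)

theorem integral_centred {y : Ω → ι → ℝ} (hy : Integrable y μ) :
    ∫ a, centred μ y a ∂μ = 0 := by
  simp only [centred]
  rw [integral_sub hy (integrable_const _)]
  simp

theorem integral_meanFieldMap {y : Ω → ι → ℝ} (hy : Integrable y μ) (M Mt : Matrix κ ι ℝ) :
    ∫ a, meanFieldMap μ M Mt y a ∂μ = (M + Mt) *ᵥ ∫ a, y a ∂μ := by
  have h : Integrable (fun a => M *ᵥ y a) μ :=
    (LinearMap.toContinuousLinearMap M.mulVecLin).integrable_comp hy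
  simp only [meanFieldMap]
  rw [integral_add h (integrable_const _), integral_mulVec hy, add_mulVec]
  simp

/-- This is the decoupling: the term `Mt 𝔼y` is deterministic and cancels, so fluctuations see only
`M` while means see `M + Mt`. -/
theorem centred_meanFieldMap {y : Ω → ι → ℝ} (hy : Integrable y μ) (M Mt : Matrix κ ι ℝ) :
    centred μ (meanFieldMap μ M Mt y) = fun a => M *ᵥ centred μ y a := by
  funext a
  simp only [centred, integral_meanFieldMap hy]
  simp only [meanFieldMap, mulVec_sub, add_mulVec]
  abel

omit [IsProbabilityMeasure μ] in
theorem centred_add {x y : Ω → ι → ℝ} (hx : Integrable x μ) (hy : Integrable y μ) :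
    centred μ (x + y) = centred μ x + centred μ y := by
  funext a
  simp only [centred, Pi.add_apply, integral_add hx hy]
  abel

omit [IsProbabilityMeasure μ] in
theorem centred_sub {x y : Ω → ι → ℝ} (hx : Integrable x μ) (hy : Integrable y μ) :
    centred μ (x - y) = centred μ x - centred μ y := by
  funext a
  simp only [centred, Pi.sub_apply, integral_sub hx hy]
  abel

/-- The second moment splits into the contributions of the centred part and of the mean. -/
theorem meanFieldForm_self {y : Ω → ι → ℝ} (hy : MemLp y 2 μ) (P : Matrix ι ι ℝ) :
    meanFieldForm μ P P y = secondMoment μ P y := by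
  have hi : Integrable y μ := hy.integrable one_le_two
  have hc := memLp_centred hy
  have hci : Integrable (centred μ y) μ := hc.integrable one_le_two
  set m := ∫ b, y b ∂μ with hm
  -- `P` need not be symmetric, so the two cross terms stay separate; each pairs the centred vector
  -- with a constant.
  have h0 : ∀ c : ι → ℝ, ∫ a, centred μ y a ⬝ᵥ c ∂μ = 0 := fun c => by
    rw [integral_dotProduct_const hci, integral_centred hi, zero_dotProduct]
  have e : ∀ a, y a ⬝ᵥ P *ᵥ y a = (centred μ y a ⬝ᵥ P *ᵥ centred μ y a
      + (centred μ y a ⬝ᵥ P *ᵥ m + centred μ y a ⬝ᵥ (m ᵥ* P))) + m ⬝ᵥ P *ᵥ m := fun a => by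
    have : y a = centred μ y a + m := by simp [centred, hm]
    nth_rewrite 1 2 [this]
    rw [mulVec_add, dotProduct_add, add_dotProduct, add_dotProduct, dotProduct_mulVec m P,
      dotProduct_comm (m ᵥ* P) (centred μ y a)]
    ring
  have hd : ∀ c : ι → ℝ, Integrable (fun a => centred μ y a ⬝ᵥ c) μ := fun c =>
    integrable_dotProduct hc (memLp_const c)
  have h1 : Integrable (fun a => centred μ y a ⬝ᵥ P *ᵥ m + centred μ y a ⬝ᵥ (m ᵥ* P)) μ :=
    (hd _).add (hd _)
  have h2 : Integrable (fun a => centred μ y a ⬝ᵥ P *ᵥ centred μ y a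
      + (centred μ y a ⬝ᵥ P *ᵥ m + centred μ y a ⬝ᵥ (m ᵥ* P))) μ :=
    (integrable_quadratic hc P).add h1
  simp only [meanFieldForm, secondMoment, e]
  rw [integral_add h2 (integrable_const _), integral_add (integrable_quadratic hc P) h1,
    integral_add (hd _) (hd _), h0, h0]
  simp [hm]

omit [IsProbabilityMeasure μ] in
theorem secondMoment_nonneg {P : Matrix ι ι ℝ} (hP : P.PosSemidef) (y : Ω → ι → ℝ) :
    0 ≤ secondMoment μ P y :=
  integral_nonneg fun a => by simpa using hP.dotProduct_mulVec_nonneg (y a)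

omit [IsProbabilityMeasure μ] in
theorem meanFieldForm_nonneg {P Q : Matrix ι ι ℝ} (hP : P.PosSemidef) (hQ : Q.PosSemidef)
    (y : Ω → ι → ℝ) : 0 ≤ meanFieldForm μ P Q y :=
  add_nonneg (secondMoment_nonneg hP _)
    (by simpa using hQ.dotProduct_mulVec_nonneg (∫ b, y b ∂μ))

-- A product of two `L²` functions is in general only integrable. Independence rescues square
-- integrability, since `ζ²` and `η²` are independent and integrable.
omit [IsProbabilityMeasure μ] in
theorem memLp_add_noise {ζ : Ω → ℝ} (hζ : MemLp ζ 2 μ) {ξ η : Ω → ι → ℝ}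
    (hind : IndepFun ζ (fun a => (ξ a, η a)) μ) (hξ : MemLp ξ 2 μ) (hη : MemLp η 2 μ) :
    MemLp (fun a => ξ a + ζ a • η a) 2 μ := by
  refine hξ.add (memLp_pi_iff.2 fun i => ?_)
  have hi : MemLp (fun a => η a i) 2 μ := hη.eval i
  have hm : AEStronglyMeasurable (fun a => ζ a * η a i) μ :=
    hζ.aestronglyMeasurable.mul hi.aestronglyMeasurable
  simp only [Pi.smul_apply, smul_eq_mul]
  rw [memLp_two_iff_integrable_sq hm]
  have h2 : IndepFun (fun a => ζ a ^ 2) (fun a => η a i ^ 2) μ :=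
    hind.comp (φ := fun t : ℝ => t ^ 2) (ψ := fun z : (ι → ℝ) × (ι → ℝ) => z.2 i ^ 2)
      (by fun_prop) (by fun_prop)
  have h3 := h2.integrable_mul hζ.integrable_sq hi.integrable_sq
  simp only [mul_pow]
  exact h3

/-- A multiplicative noise with mean zero and unit variance, independent of the present, adds
its intensity to the second moments. -/
theorem meanFieldForm_add_noise {ζ : Ω → ℝ} (hζ : MemLp ζ 2 μ) (h0 : ∫ a, ζ a ∂μ = 0)
    (h1 : ∫ a, ζ a * ζ a ∂μ = 1) {ξ η : Ω → ι → ℝ}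
    (hind : IndepFun ζ (fun a => (ξ a, η a)) μ) (hξ : MemLp ξ 2 μ) (hη : MemLp η 2 μ)
    (P Q : Matrix ι ι ℝ) :
    meanFieldForm μ P Q (fun a => ξ a + ζ a • η a)
      = meanFieldForm μ P Q ξ + meanFieldForm μ P P η := by
  have hsum := memLp_add_noise hζ hind hξ hη
  have hm : ∫ a, (ξ a + ζ a • η a) ∂μ = ∫ a, ξ a ∂μ := by
    funext i
    have hiη : Integrable (fun a => η a i) μ := (hη.eval i).integrable one_le_two
    have hiξ : Integrable (fun a => ξ a i) μ := (hξ.eval i).integrable one_le_two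
    have hζη : IndepFun ζ (fun a => η a i) μ :=
      hind.comp (φ := id) (ψ := fun z : (ι → ℝ) × (ι → ℝ) => z.2 i) measurable_id (by fun_prop)
    have hp : Integrable (fun a => ζ a * η a i) μ :=
      hζη.integrable_mul (hζ.integrable one_le_two) hiη
    have hz : ∫ a, ζ a * η a i ∂μ = 0 := by
      have := hζη.integral_mul_eq_mul_integral hζ.aestronglyMeasurable hiη.aestronglyMeasurable
      simpa [h0] using this
    rw [eval_integral (fun i => (hsum.eval i).integrable one_le_two),
      eval_integral (fun i => (hξ.eval i).integrable one_le_two)]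
    simp only [Pi.add_apply, Pi.smul_apply, smul_eq_mul]
    rw [integral_add hiξ hp, hz, add_zero]
  have hc := memLp_centred hξ
  set m := ∫ a, ξ a ∂μ with hmdef
  -- The noise term has mean zero, so all of `ζ η`, including the part driven by `𝔼η`, lies in the
  -- fluctuation. This is why `η` is weighted by `P` alone and `Q` does not appear.
  have e : ∀ a, centred μ (fun a => ξ a + ζ a • η a) a = centred μ ξ a + ζ a • η a := fun a => by
    simp only [centred, hm]
    abel
  have e' : ∀ a, centred μ (fun a => ξ a + ζ a • η a) a
        ⬝ᵥ P *ᵥ centred μ (fun a => ξ a + ζ a • η a) a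
      = centred μ ξ a ⬝ᵥ P *ᵥ centred μ ξ a
        + (ζ a * (centred μ ξ a ⬝ᵥ P *ᵥ η a + η a ⬝ᵥ P *ᵥ centred μ ξ a)
        + (ζ a * ζ a) * (η a ⬝ᵥ P *ᵥ η a)) := fun a => by
    rw [e]
    simp only [mulVec_add, mulVec_smul, dotProduct_add, add_dotProduct, smul_dotProduct,
      dotProduct_smul, smul_eq_mul]
    ring
  have hf : Integrable
      (fun a => centred μ ξ a ⬝ᵥ P *ᵥ η a + η a ⬝ᵥ P *ᵥ centred μ ξ a) μ :=
    (integrable_dotProduct hc (hη.mulVec P)).add (integrable_dotProduct hη (hc.mulVec P))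
  have hq := integrable_quadratic hη P
  have i1 : IndepFun ζ
      (fun a => centred μ ξ a ⬝ᵥ P *ᵥ η a + η a ⬝ᵥ P *ᵥ centred μ ξ a) μ :=
    hind.comp (φ := id) (ψ := fun z : (ι → ℝ) × (ι → ℝ) =>
      (z.1 - m) ⬝ᵥ P *ᵥ z.2 + z.2 ⬝ᵥ P *ᵥ (z.1 - m)) measurable_id
      (Continuous.measurable (by fun_prop))
  have i2 : IndepFun (fun a => ζ a * ζ a) (fun a => η a ⬝ᵥ P *ᵥ η a) μ :=
    hind.comp (φ := fun t : ℝ => t * t) (ψ := fun z : (ι → ℝ) × (ι → ℝ) => z.2 ⬝ᵥ P *ᵥ z.2)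
      (by fun_prop) (Continuous.measurable (by fun_prop))
  have hζζ : Integrable (fun a => ζ a * ζ a) μ := hζ.integrable_mul hζ
  have j1 : Integrable (fun a => ζ a *
      (centred μ ξ a ⬝ᵥ P *ᵥ η a + η a ⬝ᵥ P *ᵥ centred μ ξ a)) μ :=
    i1.integrable_mul (hζ.integrable one_le_two) hf
  have j2 : Integrable (fun a => (ζ a * ζ a) * (η a ⬝ᵥ P *ᵥ η a)) μ :=
    i2.integrable_mul hζζ hq
  have k1 : ∫ a, ζ a * (centred μ ξ a ⬝ᵥ P *ᵥ η a + η a ⬝ᵥ P *ᵥ centred μ ξ a) ∂μ = 0 := by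
    have := i1.integral_mul_eq_mul_integral hζ.aestronglyMeasurable hf.aestronglyMeasurable
    simpa only [h0, zero_mul, Pi.mul_apply] using this
  have k2 : ∫ a, (ζ a * ζ a) * (η a ⬝ᵥ P *ᵥ η a) ∂μ = ∫ a, η a ⬝ᵥ P *ᵥ η a ∂μ := by
    have := i2.integral_mul_eq_mul_integral hζζ.aestronglyMeasurable hq.aestronglyMeasurable
    simpa only [h1, one_mul, Pi.mul_apply] using this
  have j12 : Integrable (fun a => ζ a *
      (centred μ ξ a ⬝ᵥ P *ᵥ η a + η a ⬝ᵥ P *ᵥ centred μ ξ a)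
        + (ζ a * ζ a) * (η a ⬝ᵥ P *ᵥ η a)) μ := j1.add j2
  rw [meanFieldForm_self hη]
  simp only [meanFieldForm, secondMoment, e', hm]
  rw [integral_add (integrable_quadratic hc P) j12, integral_add j1 j2, k1, k2]
  ring

end SecondMoments

/-! ### Completing the square in one deterministic stage. -/

section CompletionOfSquares

variable {ι κ : Type*} [Fintype ι] [Fintype κ]

theorem dotProduct_transpose_mulVec_eq (M : Matrix κ ι ℝ) (x : ι → ℝ) (y : κ → ℝ) :
    x ⬝ᵥ Mᵀ *ᵥ y = (M *ᵥ x) ⬝ᵥ y := by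
  rw [dotProduct_mulVec, vecMul_transpose]

theorem dotProduct_mulVec_comm_of_isSymm {P : Matrix ι ι ℝ} (hP : P.IsSymm) (x y : ι → ℝ) :
    x ⬝ᵥ P *ᵥ y = y ⬝ᵥ P *ᵥ x := by
  nth_rewrite 1 [← hP.eq]
  rw [dotProduct_transpose_mulVec_eq, dotProduct_comm]

/-- Completion of the square for a linear-quadratic stage with multiplicative noise. -/
theorem stage_completion [DecidableEq κ] {M C P₁ P₂ W X : Matrix ι ι ℝ} {N D G : Matrix ι κ ℝ}
    {R H : Matrix κ κ ℝ} {L : Matrix κ ι ℝ} (hP₁ : P₁.IsSymm) (hP₂ : P₂.IsSymm)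
    (hH : H = R + Nᵀ * P₁ * N + Dᵀ * P₂ * D) (hG : G = Mᵀ * P₁ * N + Cᵀ * P₂ * D)
    (hpos : H.PosDef) (hX : X = Mᵀ * P₁ * M + Cᵀ * P₂ * C + W - G * H⁻¹ * Gᵀ)
    (hL : L = -(H⁻¹ * Gᵀ)) (x : ι → ℝ) (v : κ → ℝ) :
    (M *ᵥ x + N *ᵥ v) ⬝ᵥ P₁ *ᵥ (M *ᵥ x + N *ᵥ v) + (C *ᵥ x + D *ᵥ v) ⬝ᵥ P₂ *ᵥ (C *ᵥ x + D *ᵥ v)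
        + (x ⬝ᵥ W *ᵥ x + v ⬝ᵥ R *ᵥ v)
      = x ⬝ᵥ X *ᵥ x + (v - L *ᵥ x) ⬝ᵥ H *ᵥ (v - L *ᵥ x) := by
  have hHs : H.IsSymm := by simpa [IsHermitian, IsSymm] using hpos.isHermitian
  have hu : IsUnit H.det := (isUnit_iff_isUnit_det _).1 hpos.isUnit
  set g := Gᵀ *ᵥ x with hg
  have hvL : v - L *ᵥ x = v + H⁻¹ *ᵥ g := by
    rw [hL, neg_mulVec, ← mulVec_mulVec, sub_neg_eq_add]
  have hHg : H *ᵥ H⁻¹ *ᵥ g = g := by rw [mulVec_mulVec, mul_nonsing_inv _ hu, one_mulVec]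
  have hsq : (v - L *ᵥ x) ⬝ᵥ H *ᵥ (v - L *ᵥ x)
      = v ⬝ᵥ H *ᵥ v + 2 * (v ⬝ᵥ g) + (H⁻¹ *ᵥ g) ⬝ᵥ g := by
    rw [hvL, mulVec_add, hHg, add_dotProduct, dotProduct_add, dotProduct_add,
      dotProduct_mulVec_comm_of_isSymm hHs (H⁻¹ *ᵥ g) v, hHg]
    ring
  have hGH : x ⬝ᵥ (G * H⁻¹ * Gᵀ) *ᵥ x = (H⁻¹ *ᵥ g) ⬝ᵥ g := by
    rw [Matrix.mul_assoc, ← mulVec_mulVec, ← mulVec_mulVec, ← hg]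
    nth_rewrite 1 [← transpose_transpose G]
    rw [dotProduct_transpose_mulVec_eq, ← hg, dotProduct_comm]
  have hvg : v ⬝ᵥ g = (N *ᵥ v) ⬝ᵥ P₁ *ᵥ (M *ᵥ x) + (D *ᵥ v) ⬝ᵥ P₂ *ᵥ (C *ᵥ x) := by
    rw [hg, hG]
    simp only [transpose_add, transpose_mul, transpose_transpose, hP₁.eq, hP₂.eq, add_mulVec,
      dotProduct_add, ← mulVec_mulVec, dotProduct_transpose_mulVec_eq]
  rw [hsq, hX, sub_mulVec, dotProduct_sub, hGH, hvg, hH]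
  simp only [add_mulVec, mulVec_add, dotProduct_add, add_dotProduct, ← mulVec_mulVec,
    dotProduct_transpose_mulVec_eq]
  rw [dotProduct_mulVec_comm_of_isSymm hP₁ (M *ᵥ x) (N *ᵥ v),
    dotProduct_mulVec_comm_of_isSymm hP₂ (C *ᵥ x) (D *ᵥ v)]
  ring

/-- The value matrix of a linear-quadratic stage in closed-loop form. -/
theorem stage_closedLoop [DecidableEq κ] {M C P₁ P₂ W X : Matrix ι ι ℝ} {N D G : Matrix ι κ ℝ}
    {R H : Matrix κ κ ℝ} {L : Matrix κ ι ℝ} (hP₁ : P₁.IsSymm) (hP₂ : P₂.IsSymm)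
    (hH : H = R + Nᵀ * P₁ * N + Dᵀ * P₂ * D) (hG : G = Mᵀ * P₁ * N + Cᵀ * P₂ * D)
    (hpos : H.PosDef) (hX : X = Mᵀ * P₁ * M + Cᵀ * P₂ * C + W - G * H⁻¹ * Gᵀ)
    (hL : L = -(H⁻¹ * Gᵀ)) (x : ι → ℝ) :
    x ⬝ᵥ X *ᵥ x = (M *ᵥ x + N *ᵥ L *ᵥ x) ⬝ᵥ P₁ *ᵥ (M *ᵥ x + N *ᵥ L *ᵥ x)
      + (C *ᵥ x + D *ᵥ L *ᵥ x) ⬝ᵥ P₂ *ᵥ (C *ᵥ x + D *ᵥ L *ᵥ x)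
      + (x ⬝ᵥ W *ᵥ x + (L *ᵥ x) ⬝ᵥ R *ᵥ L *ᵥ x) := by
  -- The choice `v = L x` annihilates the square.
  rw [stage_completion hP₁ hP₂ hH hG hpos hX hL x (L *ᵥ x)]
  simp

theorem isSymm_stage [DecidableEq κ] {M C P₁ P₂ W : Matrix ι ι ℝ} {G : Matrix ι κ ℝ}
    {H : Matrix κ κ ℝ} (hP₁ : P₁.IsSymm) (hP₂ : P₂.IsSymm) (hW : W.IsSymm) (hpos : H.PosDef) :
    (Mᵀ * P₁ * M + Cᵀ * P₂ * C + W - G * H⁻¹ * Gᵀ).IsSymm := by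
  have hHs : H.IsSymm := by simpa [IsHermitian, IsSymm] using hpos.isHermitian
  simp only [IsSymm, transpose_sub, transpose_add, transpose_mul, transpose_transpose, hP₁.eq,
    hP₂.eq, hW.eq, transpose_nonsing_inv, hHs.eq, Matrix.mul_assoc]

theorem posSemidef_iff_real {X : Matrix ι ι ℝ} :
    X.PosSemidef ↔ X.IsSymm ∧ ∀ x : ι → ℝ, 0 ≤ x ⬝ᵥ X *ᵥ x := by
  rw [posSemidef_iff_dotProduct_mulVec]
  simp [IsHermitian, IsSymm]

/-- Discarding the minimizer in favour of the zero input bounds the value matrix. -/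
theorem posSemidef_neg_stage [DecidableEq κ] {M C P₁ P₂ W : Matrix ι ι ℝ} {G : Matrix ι κ ℝ}
    {H : Matrix κ κ ℝ} (hP₁ : (-P₁).PosSemidef) (hP₂ : (-P₂).PosSemidef)
    (hW : (-W).PosSemidef) (hpos : H.PosDef) :
    (-(Mᵀ * P₁ * M + Cᵀ * P₂ * C + W - G * H⁻¹ * Gᵀ)).PosSemidef := by
  have h₁ := hP₁.conjTranspose_mul_mul_same M
  have h₂ := hP₂.conjTranspose_mul_mul_same C
  have h₃ := hpos.inv.posSemidef.mul_mul_conjTranspose_same G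
  have h := ((h₁.add h₂).add hW).add h₃
  simp only [conjTranspose_eq_transpose_of_trivial] at h
  convert h using 1
  simp only [Matrix.mul_neg, Matrix.neg_mul]
  abel

/-- The subtracted term `G H⁻¹ Gᵀ` hides the sign; in closed-loop form the value is a sum of
nonnegative terms. -/
theorem posSemidef_stage [DecidableEq κ] {M C P₁ P₂ W X : Matrix ι ι ℝ} {N D G : Matrix ι κ ℝ}
    {R H : Matrix κ κ ℝ} {L : Matrix κ ι ℝ} (hP₁ : P₁.PosSemidef) (hP₂ : P₂.PosSemidef)
    (hW : W.PosSemidef) (hR : R.PosSemidef)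
    (hH : H = R + Nᵀ * P₁ * N + Dᵀ * P₂ * D) (hG : G = Mᵀ * P₁ * N + Cᵀ * P₂ * D)
    (hpos : H.PosDef) (hX : X = Mᵀ * P₁ * M + Cᵀ * P₂ * C + W - G * H⁻¹ * Gᵀ)
    (hL : L = -(H⁻¹ * Gᵀ)) : X.PosSemidef := by
  rw [posSemidef_iff_real] at hP₁ hP₂ hW hR ⊢
  refine ⟨hX ▸ isSymm_stage hP₁.1 hP₂.1 hW.1 hpos, fun x => ?_⟩
  rw [stage_closedLoop hP₁.1 hP₂.1 hH hG hpos hX hL x]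
  exact add_nonneg (add_nonneg (hP₁.2 _) (hP₂.2 _)) (add_nonneg (hW.2 _) (hR.2 _))

end CompletionOfSquares

/-! ### Quadratic bounds for matrices. -/

section Bounds

variable {ι κ : Type*} [Fintype ι] [Fintype κ]

theorem dotProduct_self_nonneg_real (x : ι → ℝ) : 0 ≤ x ⬝ᵥ x :=
  Finset.sum_nonneg fun i _ => mul_self_nonneg (x i)

/-- Cauchy–Schwarz in each row; the constant is the squared Frobenius norm. -/
theorem exists_mulVec_bound (M : Matrix κ ι ℝ) :
    ∃ c : ℝ, 0 ≤ c ∧ ∀ x : ι → ℝ, (M *ᵥ x) ⬝ᵥ (M *ᵥ x) ≤ c * (x ⬝ᵥ x) := by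
  refine ⟨∑ i, M i ⬝ᵥ M i, Finset.sum_nonneg fun i _ => dotProduct_self_nonneg_real _,
    fun x => ?_⟩
  rw [Finset.sum_mul]
  refine Finset.sum_le_sum fun i _ => ?_
  have := Finset.sum_mul_sq_le_sq_mul_sq Finset.univ (M i) x
  simp only [mulVec, dotProduct, ← pow_two]
  simpa using this

-- Factor `H = Bᵀ B` with `B` invertible and bound `x = B⁻¹ (B x)` in terms of `B x`.
open scoped MatrixOrder Matrix.Norms.L2Operator in
theorem exists_posDef_lower_bound [DecidableEq ι] {H : Matrix ι ι ℝ} (hH : H.PosDef) :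
    ∃ c : ℝ, 0 < c ∧ ∀ x : ι → ℝ, c * (x ⬝ᵥ x) ≤ x ⬝ᵥ H *ᵥ x := by
  obtain ⟨B, rfl⟩ : ∃ B : Matrix ι ι ℝ, H = Bᵀ * B := by
    obtain ⟨B, hB⟩ := CStarAlgebra.nonneg_iff_eq_star_mul_self.mp hH.posSemidef.nonneg
    exact ⟨B, by simpa [star_eq_conjTranspose] using hB⟩
  have hB : IsUnit B.det := by
    have h := (isUnit_iff_isUnit_det _).1 hH.isUnit
    rw [det_mul] at h
    exact isUnit_of_mul_isUnit_right h
  obtain ⟨c, hc0, hc⟩ := exists_mulVec_bound B⁻¹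
  -- The `+ 1` covers the case `c = 0`.
  refine ⟨(c + 1)⁻¹, by positivity, fun x => ?_⟩
  have h := hc (B *ᵥ x)
  rw [mulVec_mulVec, nonsing_inv_mul _ hB, one_mulVec] at h
  rw [← mulVec_mulVec, dotProduct_transpose_mulVec_eq, inv_mul_le_iff₀ (by positivity)]
  nlinarith [dotProduct_self_nonneg_real (B *ᵥ x)]

theorem dotProduct_self_add_le (x y : ι → ℝ) :
    (x + y) ⬝ᵥ (x + y) ≤ 2 * (x ⬝ᵥ x) + 2 * (y ⬝ᵥ y) := by
  have := dotProduct_self_nonneg_real (x - y)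
  simp only [sub_dotProduct, dotProduct_sub, add_dotProduct, dotProduct_add] at this ⊢
  linarith

end Bounds

/-! ### Stage identities and bounds for random vectors. -/

section MeanFieldStage

variable {Ω ι κ ρ : Type*} [MeasurableSpace Ω] [Fintype ι] [Fintype κ] [Fintype ρ]
  {μ : Measure Ω} [IsProbabilityMeasure μ]

theorem meanFieldForm_eq_integral {x : Ω → ι → ℝ} {v : Ω → κ → ℝ} (hx : MemLp x 2 μ)
    (hv : MemLp v 2 μ) (M Mt : Matrix ρ ι ℝ) (N Nt : Matrix ρ κ ℝ) (P Q : Matrix ρ ρ ℝ) :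
    meanFieldForm μ P Q (meanFieldMap μ M Mt x + meanFieldMap μ N Nt v)
      = ∫ a, (M *ᵥ centred μ x a + N *ᵥ centred μ v a)
            ⬝ᵥ P *ᵥ (M *ᵥ centred μ x a + N *ᵥ centred μ v a) ∂μ
        + ((M + Mt) *ᵥ (∫ a, x a ∂μ) + (N + Nt) *ᵥ ∫ a, v a ∂μ)
            ⬝ᵥ Q *ᵥ ((M + Mt) *ᵥ (∫ a, x a ∂μ) + (N + Nt) *ᵥ ∫ a, v a ∂μ) := by
  have ix := hx.integrable one_le_two
  have iv := hv.integrable one_le_two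
  have ix' := (memLp_meanFieldMap hx M Mt).integrable one_le_two
  have iv' := (memLp_meanFieldMap hv N Nt).integrable one_le_two
  rw [meanFieldForm, secondMoment, centred_add ix' iv', centred_meanFieldMap ix,
    centred_meanFieldMap iv]
  simp only [Pi.add_apply]
  rw [integral_add ix' iv', integral_meanFieldMap ix, integral_meanFieldMap iv]

/-- The mean-field version of the completion of squares in a linear-quadratic stage. -/
theorem meanField_stage {x : Ω → ι → ℝ} {v : Ω → κ → ℝ} (hx : MemLp x 2 μ) (hv : MemLp v 2 μ)
    {M Mt C Ct P₁ Q₁ W Wt X Y : Matrix ι ι ℝ} {N Nt D Dt : Matrix ι κ ℝ}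
    {R H Ht : Matrix κ κ ℝ} {L Lt : Matrix κ ι ℝ}
    (h : ∀ (x : ι → ℝ) (v : κ → ℝ),
      (M *ᵥ x + N *ᵥ v) ⬝ᵥ P₁ *ᵥ (M *ᵥ x + N *ᵥ v)
        + (C *ᵥ x + D *ᵥ v) ⬝ᵥ P₁ *ᵥ (C *ᵥ x + D *ᵥ v) + (x ⬝ᵥ W *ᵥ x + v ⬝ᵥ R *ᵥ v)
      = x ⬝ᵥ X *ᵥ x + (v - L *ᵥ x) ⬝ᵥ H *ᵥ (v - L *ᵥ x))
    (ht : ∀ (x : ι → ℝ) (v : κ → ℝ),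
      ((M + Mt) *ᵥ x + (N + Nt) *ᵥ v) ⬝ᵥ Q₁ *ᵥ ((M + Mt) *ᵥ x + (N + Nt) *ᵥ v)
        + ((C + Ct) *ᵥ x + (D + Dt) *ᵥ v) ⬝ᵥ P₁ *ᵥ ((C + Ct) *ᵥ x + (D + Dt) *ᵥ v)
        + (x ⬝ᵥ Wt *ᵥ x + v ⬝ᵥ R *ᵥ v)
      = x ⬝ᵥ Y *ᵥ x + (v - (L + Lt) *ᵥ x) ⬝ᵥ Ht *ᵥ (v - (L + Lt) *ᵥ x)) :
    meanFieldForm μ P₁ Q₁ (meanFieldMap μ M Mt x + meanFieldMap μ N Nt v)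
        + meanFieldForm μ P₁ P₁ (meanFieldMap μ C Ct x + meanFieldMap μ D Dt v)
        + (meanFieldForm μ W Wt x + secondMoment μ R v)
      = meanFieldForm μ X Y x + meanFieldForm μ H Ht (v - meanFieldMap μ L Lt x) := by
  have ix := hx.integrable one_le_two
  have iv := hv.integrable one_le_two
  have cx := memLp_centred hx
  have cv := memLp_centred hv
  have lx := memLp_meanFieldMap hx L Lt
  have e1 : Integrable (fun a => (M *ᵥ centred μ x a + N *ᵥ centred μ v a)
      ⬝ᵥ P₁ *ᵥ (M *ᵥ centred μ x a + N *ᵥ centred μ v a)) μ :=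
    integrable_quadratic ((cx.mulVec M).add (cv.mulVec N)) P₁
  have e2 : Integrable (fun a => (C *ᵥ centred μ x a + D *ᵥ centred μ v a)
      ⬝ᵥ P₁ *ᵥ (C *ᵥ centred μ x a + D *ᵥ centred μ v a)) μ :=
    integrable_quadratic ((cx.mulVec C).add (cv.mulVec D)) P₁
  have e3 := integrable_quadratic cx W
  have e4 := integrable_quadratic cv R
  have e5 := integrable_quadratic cx X
  have e6 : Integrable (fun a => (centred μ v a - L *ᵥ centred μ x a)
      ⬝ᵥ H *ᵥ (centred μ v a - L *ᵥ centred μ x a)) μ :=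
    integrable_quadratic (cv.sub (cx.mulVec L)) H
  have e12 : Integrable (fun a => (M *ᵥ centred μ x a + N *ᵥ centred μ v a)
      ⬝ᵥ P₁ *ᵥ (M *ᵥ centred μ x a + N *ᵥ centred μ v a)
      + (C *ᵥ centred μ x a + D *ᵥ centred μ v a)
      ⬝ᵥ P₁ *ᵥ (C *ᵥ centred μ x a + D *ᵥ centred μ v a)) μ := e1.add e2
  have e34 : Integrable (fun a => centred μ x a ⬝ᵥ W *ᵥ centred μ x a
      + centred μ v a ⬝ᵥ R *ᵥ centred μ v a) μ := e3.add e4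
  have key : ∫ a, ((M *ᵥ centred μ x a + N *ᵥ centred μ v a)
        ⬝ᵥ P₁ *ᵥ (M *ᵥ centred μ x a + N *ᵥ centred μ v a)
        + (C *ᵥ centred μ x a + D *ᵥ centred μ v a)
        ⬝ᵥ P₁ *ᵥ (C *ᵥ centred μ x a + D *ᵥ centred μ v a)
        + (centred μ x a ⬝ᵥ W *ᵥ centred μ x a + centred μ v a ⬝ᵥ R *ᵥ centred μ v a)) ∂μ
      = ∫ a, (centred μ x a ⬝ᵥ X *ᵥ centred μ x a + (centred μ v a - L *ᵥ centred μ x a)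
        ⬝ᵥ H *ᵥ (centred μ v a - L *ᵥ centred μ x a)) ∂μ :=
    integral_congr_ae (Filter.Eventually.of_forall fun a => h (centred μ x a) (centred μ v a))
  rw [integral_add e12 e34, integral_add e1 e2, integral_add e3 e4, integral_add e5 e6] at key
  have keyt := ht (∫ a, x a ∂μ) (∫ a, v a ∂μ)
  -- The input cost has the same weight `R` on fluctuation and mean, so it can be split to match the
  -- two deterministic identities.
  rw [meanFieldForm_eq_integral hx hv, meanFieldForm_eq_integral hx hv, ← meanFieldForm_self hv]
  simp only [meanFieldForm, secondMoment]
  rw [centred_sub iv (lx.integrable one_le_two), centred_meanFieldMap ix]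
  simp only [Pi.sub_apply]
  rw [integral_sub iv (lx.integrable one_le_two), integral_meanFieldMap ix]
  linarith

omit [IsProbabilityMeasure μ] in
theorem secondMoment_one [DecidableEq ι] (y : Ω → ι → ℝ) :
    secondMoment μ 1 y = ∫ a, y a ⬝ᵥ y a ∂μ := by
  simp [secondMoment]

theorem meanFieldForm_add {y : Ω → ι → ℝ} (hy : MemLp y 2 μ) (P P' Q Q' : Matrix ι ι ℝ) :
    meanFieldForm μ (P + P') (Q + Q') y = meanFieldForm μ P Q y + meanFieldForm μ P' Q' y := by
  have hc := memLp_centred hy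
  simp only [meanFieldForm, secondMoment, add_mulVec, dotProduct_add]
  rw [integral_add (integrable_quadratic hc P) (integrable_quadratic hc P')]
  ring

omit [IsProbabilityMeasure μ] in
theorem meanFieldForm_zero (P Q : Matrix ι ι ℝ) : meanFieldForm μ P Q 0 = 0 := by
  simp [meanFieldForm, secondMoment, centred]

omit [IsProbabilityMeasure μ] in
theorem meanFieldForm_neg (y : Ω → ι → ℝ) (P Q : Matrix ι ι ℝ) :
    meanFieldForm μ (-P) (-Q) y = -meanFieldForm μ P Q y := by
  simp only [meanFieldForm, secondMoment, neg_mulVec, dotProduct_neg]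
  rw [integral_neg]
  ring

omit [IsProbabilityMeasure μ] in
theorem meanFieldForm_smul (y : Ω → ι → ℝ) (c : ℝ) (P Q : Matrix ι ι ℝ) :
    meanFieldForm μ (c • P) (c • Q) y = c * meanFieldForm μ P Q y := by
  simp only [meanFieldForm, secondMoment, smul_mulVec, dotProduct_smul, smul_eq_mul]
  rw [integral_const_mul]
  ring

theorem meanFieldForm_mono {y : Ω → ι → ℝ} (hy : MemLp y 2 μ) {P P' Q Q' : Matrix ι ι ℝ}
    (hP : ∀ x : ι → ℝ, x ⬝ᵥ P *ᵥ x ≤ x ⬝ᵥ P' *ᵥ x)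
    (hQ : ∀ x : ι → ℝ, x ⬝ᵥ Q *ᵥ x ≤ x ⬝ᵥ Q' *ᵥ x) :
    meanFieldForm μ P Q y ≤ meanFieldForm μ P' Q' y :=
  add_le_add (integral_mono (integrable_quadratic (memLp_centred hy) P)
    (integrable_quadratic (memLp_centred hy) P') fun _ => hP _) (hQ _)

theorem meanFieldForm_smul_one [DecidableEq ι] {y : Ω → ι → ℝ} (hy : MemLp y 2 μ) (c : ℝ) :
    meanFieldForm μ (c • 1) (c • 1) y = c * ∫ a, y a ⬝ᵥ y a ∂μ := by
  rw [meanFieldForm_smul, meanFieldForm_self hy, secondMoment_one]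

/-- The mean square of a mean-field linear image. -/
theorem integral_meanFieldMap_sq {y : Ω → ι → ℝ} (hy : MemLp y 2 μ) (M Mt : Matrix κ ι ℝ) :
    ∫ a, meanFieldMap μ M Mt y a ⬝ᵥ meanFieldMap μ M Mt y a ∂μ
      = meanFieldForm μ (Mᵀ * M) ((M + Mt)ᵀ * (M + Mt)) y := by
  classical
  rw [← secondMoment_one, ← meanFieldForm_self (memLp_meanFieldMap hy M Mt), meanFieldForm,
    centred_meanFieldMap (hy.integrable one_le_two),
    integral_meanFieldMap (hy.integrable one_le_two)]
  simp only [meanFieldForm, secondMoment, one_mulVec, ← mulVec_mulVec,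
    dotProduct_transpose_mulVec_eq]

/-- The constant is chosen before `y`; this uniformity is what the attenuation estimate needs. -/
theorem exists_meanFieldMap_bound (μ : Measure Ω) [IsProbabilityMeasure μ] (M Mt : Matrix κ ι ℝ) :
    ∃ c : ℝ, 0 ≤ c ∧ ∀ y : Ω → ι → ℝ, MemLp y 2 μ →
      ∫ a, meanFieldMap μ M Mt y a ⬝ᵥ meanFieldMap μ M Mt y a ∂μ ≤ c * ∫ a, y a ⬝ᵥ y a ∂μ := by
  classical
  obtain ⟨c, hc0, hc⟩ := exists_mulVec_bound M
  obtain ⟨d, hd0, hd⟩ := exists_mulVec_bound (M + Mt)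
  refine ⟨c + d, by positivity, fun y hy => ?_⟩
  rw [integral_meanFieldMap_sq hy, ← meanFieldForm_smul_one hy]
  refine meanFieldForm_mono hy (fun x => ?_) (fun x => ?_) <;>
  · rw [← mulVec_mulVec, dotProduct_transpose_mulVec_eq, smul_mulVec, one_mulVec,
      dotProduct_smul, smul_eq_mul]
    nlinarith [hc x, hd x, dotProduct_self_nonneg_real x]

theorem exists_meanFieldForm_lower_bound [DecidableEq ι] (μ : Measure Ω)
    [IsProbabilityMeasure μ] {H Ht : Matrix ι ι ℝ} (hH : H.PosDef) (hHt : Ht.PosDef) :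
    ∃ c : ℝ, 0 ≤ c ∧ ∀ y : Ω → ι → ℝ, MemLp y 2 μ →
      ∫ a, y a ⬝ᵥ y a ∂μ ≤ c * meanFieldForm μ H Ht y := by
  obtain ⟨c, hc0, hc⟩ := exists_posDef_lower_bound hH
  obtain ⟨d, hd0, hd⟩ := exists_posDef_lower_bound hHt
  refine ⟨(min c d)⁻¹, by positivity, fun y hy => ?_⟩
  rw [← inv_mul_le_iff₀ (by positivity), inv_inv, ← meanFieldForm_smul_one hy]
  refine meanFieldForm_mono hy (fun x => ?_) (fun x => ?_) <;>
    rw [smul_mulVec, one_mulVec, dotProduct_smul, smul_eq_mul]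
  · exact (mul_le_mul_of_nonneg_right (min_le_left c d) (dotProduct_self_nonneg_real x)).trans
      (hc x)
  · exact (mul_le_mul_of_nonneg_right (min_le_right c d) (dotProduct_self_nonneg_real x)).trans
      (hd x)

omit [IsProbabilityMeasure μ] in
theorem integral_add_sq_le {x y : Ω → ι → ℝ} (hx : MemLp x 2 μ) (hy : MemLp y 2 μ) :
    ∫ a, (x + y) a ⬝ᵥ (x + y) a ∂μ
      ≤ 2 * ∫ a, x a ⬝ᵥ x a ∂μ + 2 * ∫ a, y a ⬝ᵥ y a ∂μ := by
  have ix := (integrable_dotProduct hx hx).const_mul 2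
  have iy := (integrable_dotProduct hy hy).const_mul 2
  rw [← integral_const_mul, ← integral_const_mul, ← integral_add ix iy]
  exact integral_mono (integrable_dotProduct (hx.add hy) (hx.add hy)) (ix.add iy)
    fun a => dotProduct_self_add_le (x a) (y a)

end MeanFieldStage

/-! ### Adaptedness to the noise filtration. -/

section Adapted

variable {Ω ι κ : Type*} [MeasurableSpace Ω] [Fintype ι] [Fintype κ] {μ : Measure Ω}
  {K : ℕ} {w : ℕ → Ω → ℝ}

/-- Square integrable and measurable with respect to the noise before time `k`. -/
def AdaptedL2 (μ : Measure Ω) (w : ℕ → Ω → ℝ) (k : ℕ) (y : Ω → ι → ℝ) : Prop :=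
  Measurable[pastSigma w k] y ∧ MemLp y 2 μ

theorem AdaptedL2.meanFieldMap [IsProbabilityMeasure μ] {k : ℕ} {y : Ω → ι → ℝ}
    (hy : AdaptedL2 μ w k y) (M Mt : Matrix κ ι ℝ) :
    AdaptedL2 μ w k (meanFieldMap μ M Mt y) := by
  refine ⟨?_, memLp_meanFieldMap hy.2 M Mt⟩
  have hM : Measurable fun v : ι → ℝ => M *ᵥ v + Mt *ᵥ ∫ b, y b ∂μ :=
    Continuous.measurable (by fun_prop)
  exact hM.comp hy.1

theorem AdaptedL2.add {k : ℕ} {x y : Ω → ι → ℝ} (hx : AdaptedL2 μ w k x)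
    (hy : AdaptedL2 μ w k y) : AdaptedL2 μ w k (x + y) :=
  ⟨hx.1.add hy.1, hx.2.add hy.2⟩

omit [MeasurableSpace Ω] in
theorem pastSigma_le_succ (w : ℕ → Ω → ℝ) (k : ℕ) : pastSigma w k ≤ pastSigma w (k + 1) :=
  iSup₂_le fun j hj => le_iSup₂_of_le j (by omega) le_rfl

omit [MeasurableSpace Ω] in
theorem measurable_noise_succ (w : ℕ → Ω → ℝ) (k : ℕ) :
    Measurable[pastSigma w (k + 1)] (w k) :=
  Measurable.of_comap_le (le_iSup₂_of_le k (Nat.lt_succ_self k) le_rfl)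

theorem IsNoise.indepFun (hw : IsNoise μ K w) {k : ℕ} (hk : k ≤ K) {ξ η : Ω → ι → ℝ}
    (hξ : AdaptedL2 μ w k ξ) (hη : AdaptedL2 μ w k η) :
    IndepFun (w k) (fun a => (ξ a, η a)) μ := by
  rw [IndepFun_iff_Indep]
  exact indep_of_indep_of_le_right (hw.indep k hk) (hξ.1.prodMk hη.1).comap_le

theorem IsNoise.adaptedL2_add_noise (hw : IsNoise μ K w) {k : ℕ} (hk : k ≤ K)
    {ξ η : Ω → ι → ℝ} (hξ : AdaptedL2 μ w k ξ) (hη : AdaptedL2 μ w k η) :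
    AdaptedL2 μ w (k + 1) (fun a => ξ a + w k a • η a) := by
  refine ⟨?_, memLp_add_noise (hw.memLp k hk) (hw.indepFun hk hξ hη) hξ.2 hη.2⟩
  have h1 : Measurable[pastSigma w (k + 1)] ξ := hξ.1.mono (pastSigma_le_succ w k) le_rfl
  have h2 : Measurable[pastSigma w (k + 1)] η := hη.1.mono (pastSigma_le_succ w k) le_rfl
  exact h1.add ((measurable_noise_succ w k).smul h2)

theorem IsNoise.meanFieldForm_add_noise [IsProbabilityMeasure μ] (hw : IsNoise μ K w) {k : ℕ}
    (hk : k ≤ K) {ξ η : Ω → ι → ℝ} (hξ : AdaptedL2 μ w k ξ) (hη : AdaptedL2 μ w k η)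
    (P Q : Matrix ι ι ℝ) :
    meanFieldForm μ P Q (fun a => ξ a + w k a • η a)
      = meanFieldForm μ P Q ξ + meanFieldForm μ P P η :=
  _root_.meanFieldForm_add_noise (hw.memLp k hk) (hw.mean k hk)
    (by simpa using hw.cov k hk k hk) (hw.indepFun hk hξ hη) hξ.2 hη.2 P Q

end Adapted

/-! ### Admissible input policies. -/

section Policies

variable {Ω : Type*} [MeasurableSpace Ω] {n p : ℕ} {μ : Measure Ω} {K : ℕ} {w : ℕ → Ω → ℝ}

/-- A policy that turns adapted square integrable states into adapted square integrable inputs. -/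
def Policy.Admissible (μ : Measure Ω) (w : ℕ → Ω → ℝ) (K : ℕ) (c : Policy Ω n p) : Prop :=
  ∀ k ≤ K, ∀ x : Ω → Fin n → ℝ, AdaptedL2 μ w k x → AdaptedL2 μ w k (c k x)

theorem admissible_openLoop {y : ℕ → Ω → Fin p → ℝ} (hy : MemL2w μ K w y) :
    Policy.Admissible (n := n) μ w K (openLoop y) :=
  fun k hk _ _ => hy k hk

theorem feedback_apply (U Ut : ℕ → Matrix (Fin p) (Fin n) ℝ) (k : ℕ) (x : Ω → Fin n → ℝ) :
    feedback μ U Ut k x = meanFieldMap μ (U k) (Ut k) x :=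
  rfl

theorem admissible_feedback [IsProbabilityMeasure μ] (U Ut : ℕ → Matrix (Fin p) (Fin n) ℝ) :
    Policy.Admissible μ w K (feedback μ U Ut) :=
  fun _ _ _ hx => hx.meanFieldMap _ _

end Policies

/-! ### Trajectories and their integrability. -/

section Trajectories

variable {Ω : Type*} [MeasurableSpace Ω] {n l q m₁ m₂ : ℕ} {μ : Measure Ω}
  [IsProbabilityMeasure μ] (S : MFSystem n l q m₁ m₂) {K : ℕ} {w : ℕ → Ω → ℝ}

omit [IsProbabilityMeasure μ] in
theorem MFSystem.step_eq (k : ℕ) (x : Ω → Fin n → ℝ) (u : Ω → Fin q → ℝ) (v : Ω → Fin l → ℝ) :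
    S.step μ w k x u v = fun a =>
      (meanFieldMap μ (S.A k) (S.At k) x + meanFieldMap μ (S.B k) (S.Bt k) v
        + meanFieldMap μ (S.F k) 0 u) a
      + w k a • (meanFieldMap μ (S.C k) (S.Ct k) x + meanFieldMap μ (S.D k) (S.Dt k) v) a := by
  funext a
  simp only [MFSystem.step, meanFieldMap, Pi.add_apply, zero_mulVec, add_zero, ← add_assoc]
  abel

omit [IsProbabilityMeasure μ] in
theorem MFSystem.step_feedback_control (k : ℕ) (x : Ω → Fin n → ℝ) (v : Ω → Fin l → ℝ)
    (U Ut : ℕ → Matrix (Fin q) (Fin n) ℝ) :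
    S.step μ w k x (feedback μ U Ut k x) v = fun a =>
      (meanFieldMap μ (S.A k + S.F k * U k) (S.At k + S.F k * Ut k) x
        + meanFieldMap μ (S.B k) (S.Bt k) v) a
      + w k a • (meanFieldMap μ (S.C k) (S.Ct k) x + meanFieldMap μ (S.D k) (S.Dt k) v) a := by
  rw [S.step_eq]
  funext a
  simp only [feedback, meanFieldMap, Pi.add_apply, zero_mulVec, add_zero, mulVec_add, add_mulVec,
    ← mulVec_mulVec]
  abel

/-- The disturbance also enters through its mean `(V + Vt) 𝔼x`, which produces the extra `Bt` and
`Dt` terms. The control enters neither the noise nor through its mean, hence the zero coefficients.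
-/
theorem MFSystem.step_feedback_disturbance (k : ℕ) {x : Ω → Fin n → ℝ} (hx : Integrable x μ)
    (u : Ω → Fin q → ℝ) (V Vt : ℕ → Matrix (Fin l) (Fin n) ℝ) :
    S.step μ w k x u (feedback μ V Vt k x) = fun a =>
      (meanFieldMap μ (S.A k + S.B k * V k)
          (S.At k + S.B k * Vt k + S.Bt k * (V k + Vt k)) x
        + meanFieldMap μ (S.F k) 0 u) a
      + w k a • (meanFieldMap μ (S.C k + S.D k * V k)
          (S.Ct k + S.D k * Vt k + S.Dt k * (V k + Vt k)) x
        + meanFieldMap μ (0 : Matrix (Fin n) (Fin q) ℝ) 0 u) a := by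
  rw [S.step_eq]
  funext a
  have h := integral_meanFieldMap hx (V k) (Vt k)
  rw [feedback_apply]
  simp only [meanFieldMap, Pi.add_apply] at h ⊢
  rw [h]
  simp only [zero_mulVec, add_zero, mulVec_add, add_mulVec, ← mulVec_mulVec]
  congr 1
  · abel
  · congr 1
    abel

variable {S} {x₀ : Fin n → ℝ} {c : Policy Ω n q} {d : Policy Ω n l}

theorem MFSystem.adaptedL2_state (hw : IsNoise μ K w) (hc : c.Admissible μ w K)
    (hd : d.Admissible μ w K) : ∀ k ≤ K + 1, AdaptedL2 μ w k (S.state μ w x₀ c d k) := by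
  intro k
  induction k with
  | zero => exact fun _ => ⟨measurable_const, memLp_const _⟩
  | succ k ih =>
    intro hk
    have hk' : k ≤ K := by omega
    have hx := ih (by omega)
    have hu := hc k hk' _ hx
    have hv := hd k hk' _ hx
    rw [MFSystem.state, S.step_eq]
    exact hw.adaptedL2_add_noise hk'
      (((hx.meanFieldMap _ _).add (hv.meanFieldMap _ _)).add (hu.meanFieldMap _ _))
      ((hx.meanFieldMap _ _).add (hv.meanFieldMap _ _))

theorem MFSystem.memL2w_signals (hw : IsNoise μ K w) (hc : c.Admissible μ w K)
    (hd : d.Admissible μ w K) :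
    MemL2w μ K w (S.state μ w x₀ c d) ∧ MemL2w μ K w (S.control μ w x₀ c d) ∧
      MemL2w μ K w (S.disturbance μ w x₀ c d) ∧ MemL2w μ K w (S.output μ w x₀ c d) := by
  have hx : ∀ k ≤ K, AdaptedL2 μ w k (S.state μ w x₀ c d k) := fun k hk =>
    MFSystem.adaptedL2_state hw hc hd k (by omega)
  have hu : ∀ k ≤ K, AdaptedL2 μ w k (S.control μ w x₀ c d k) := fun k hk => hc k hk _ (hx k hk)
  refine ⟨hx, hu, fun k hk => hd k hk _ (hx k hk), fun k hk => ⟨?_, ?_⟩⟩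
  · have h1 : Measurable fun v : Fin n → ℝ => S.Φ k *ᵥ v := Continuous.measurable (by fun_prop)
    have h2 : Measurable fun v : Fin q → ℝ => S.Ψ k *ᵥ v := Continuous.measurable (by fun_prop)
    have h3 : Measurable[pastSigma w k] fun a => S.Φ k *ᵥ S.state μ w x₀ c d k a :=
      h1.comp (hx k hk).1
    have h4 : Measurable[pastSigma w k] fun a => S.Ψ k *ᵥ S.control μ w x₀ c d k a :=
      h2.comp (hu k hk).1
    refine @measurable_pi_lambda _ _ _ (pastSigma w k) _ _ fun i => ?_
    cases i with
    | inl i => exact (measurable_pi_apply i).comp h3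
    | inr i => exact (measurable_pi_apply i).comp h4
  · refine memLp_pi_iff.2 fun i => ?_
    cases i with
    | inl i => exact ((hx k hk).2.mulVec (S.Φ k)).eval i
    | inr i => exact ((hu k hk).2.mulVec (S.Ψ k)).eval i

/-- Since `Ψ` is an isometry, the control contributes exactly its own energy to the output. -/
theorem MFSystem.integral_output_sq (hw : IsNoise μ K w) (hc : c.Admissible μ w K)
    (hd : d.Admissible μ w K) {k : ℕ} (hk : k ≤ K) (hΨ : (S.Ψ k)ᵀ * S.Ψ k = 1) :
    ∫ a, S.output μ w x₀ c d k a ⬝ᵥ S.output μ w x₀ c d k a ∂μ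
      = meanFieldForm μ ((S.Φ k)ᵀ * S.Φ k) ((S.Φ k)ᵀ * S.Φ k) (S.state μ w x₀ c d k)
        + ∫ a, S.control μ w x₀ c d k a ⬝ᵥ S.control μ w x₀ c d k a ∂μ := by
  have hs := MFSystem.memL2w_signals (S := S) (x₀ := x₀) hw hc hd
  have hx := (hs.1 k hk).2
  have hu := (hs.2.1 k hk).2
  have e : ∀ a, S.output μ w x₀ c d k a ⬝ᵥ S.output μ w x₀ c d k a
      = S.state μ w x₀ c d k a ⬝ᵥ ((S.Φ k)ᵀ * S.Φ k) *ᵥ S.state μ w x₀ c d k a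
        + S.control μ w x₀ c d k a ⬝ᵥ S.control μ w x₀ c d k a := fun a => by
    have : S.control μ w x₀ c d k a ⬝ᵥ S.control μ w x₀ c d k a
        = (S.Ψ k *ᵥ S.control μ w x₀ c d k a) ⬝ᵥ (S.Ψ k *ᵥ S.control μ w x₀ c d k a) := by
      rw [← dotProduct_transpose_mulVec_eq, mulVec_mulVec, hΨ, one_mulVec]
    rw [this, ← mulVec_mulVec, dotProduct_transpose_mulVec_eq]
    simp only [MFSystem.output, sumElim_dotProduct_sumElim]
  simp only [e]
  rw [integral_add (integrable_quadratic hx _) (integrable_dotProduct hu hu),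
    meanFieldForm_self hx, secondMoment]

end Trajectories

/-! ### Signs and symmetry of the value matrices. -/

theorem backward_induction {p : ℕ → Prop} {N : ℕ} (h0 : p N) (hs : ∀ k < N, p (k + 1) → p k) :
    ∀ k ≤ N, p k := by
  intro k hk
  induction hk using Nat.decreasingInduction with
  | self => exact h0
  | of_succ k hk ih => exact hs k hk ih

section Coupled

variable {n l q m₁ m₂ : ℕ} {S : MFSystem n l q m₁ m₂} {K : ℕ} {γ : ℝ}
  {P Q Pt Qt : ℕ → Matrix (Fin n) (Fin n) ℝ} {U Ut : ℕ → Matrix (Fin q) (Fin n) ℝ}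
  {V Vt : ℕ → Matrix (Fin l) (Fin n) ℝ}

/-- The excess of the attenuation cost at time `k` over the value, for the disturbance `d`. -/
noncomputable def MFSystem.attenuationGap {Ω : Type*} [MeasurableSpace Ω]
    (S : MFSystem n l q m₁ m₂) (μ : Measure Ω)
    (w : ℕ → Ω → ℝ) (γ : ℝ) (P Q : ℕ → Matrix (Fin n) (Fin n) ℝ)
    (U Ut : ℕ → Matrix (Fin q) (Fin n) ℝ) (V Vt : ℕ → Matrix (Fin l) (Fin n) ℝ)
    (x₀ : Fin n → ℝ) (d : Policy Ω n l) (k : ℕ) : ℝ :=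
  meanFieldForm μ (S.H γ k (P (k + 1))) (S.Ht γ k (P (k + 1)) (Q (k + 1)))
    (S.disturbance μ w x₀ (feedback μ U Ut) d k
      - feedback μ V Vt k (S.state μ w x₀ (feedback μ U Ut) d k))

namespace MFSystem.SolvesCoupled

/-- All terms of the recursions for `P` and `Q` are nonpositive once the next values are; only
positivity of `H` and `Ht` is used. -/
theorem posSemidef_neg (h : S.SolvesCoupled γ K P Q Pt Qt U Ut V Vt) :
    ∀ k ≤ K + 1, (-P k).PosSemidef ∧ (-Q k).PosSemidef := by
  refine backward_induction ?_ fun k hk ih => ?_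
  · rw [h.final_P, h.final_Q, neg_zero]
    exact ⟨PosSemidef.zero, PosSemidef.zero⟩
  · have hk : k ≤ K := by omega
    have hU : ∀ X : Matrix (Fin q) (Fin n) ℝ,
        (-(-((S.Φ k)ᵀ * S.Φ k) - Xᵀ * X)).PosSemidef := fun X => by
      have h1 := (posSemidef_conjTranspose_mul_self (S.Φ k)).add
        (posSemidef_conjTranspose_mul_self X)
      simp only [conjTranspose_eq_transpose_of_trivial] at h1
      convert h1 using 1
      abel
    constructor
    · have := posSemidef_neg_stage (M := S.A k + S.F k * U k) (C := S.C k)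
        (G := S.Gu k (U k) (P (k + 1))) ih.1 ih.1 (hU (U k)) (h.pos_H k hk)
      rw [h.eq_P k hk]
      convert this using 2
      abel
    · have := posSemidef_neg_stage (M := S.A k + S.At k + S.F k * (U k + Ut k))
        (C := S.C k + S.Ct k) (G := S.Gut k (U k + Ut k) (P (k + 1)) (Q (k + 1)))
        ih.2 ih.1 (hU (U k + Ut k)) (h.pos_Ht k hk)
      rw [h.eq_Q k hk]
      convert this using 2
      abel

theorem posSemidef_tilde (h : S.SolvesCoupled γ K P Q Pt Qt U Ut V Vt) :
    ∀ k ≤ K + 1, (Pt k).PosSemidef ∧ (Qt k).PosSemidef := by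
  refine backward_induction ?_ fun k hk ih => ?_
  · rw [h.final_Pt, h.final_Qt]
    exact ⟨PosSemidef.zero, PosSemidef.zero⟩
  · have hk : k ≤ K := by omega
    have hΦ : ((S.Φ k)ᵀ * S.Φ k).PosSemidef := by
      simpa only [conjTranspose_eq_transpose_of_trivial] using
        posSemidef_conjTranspose_mul_self (S.Φ k)
    exact ⟨posSemidef_stage (N := S.F k) (D := 0) ih.1 ih.1 hΦ PosSemidef.one (by simp [MFSystem.H₁])
        (by simp [MFSystem.Gv]) (h.pos_H₁ k hk) (h.eq_Pt k hk) (h.eq_U k hk),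
      posSemidef_stage (N := S.F k) (D := 0) ih.2 ih.1 hΦ PosSemidef.one (by simp [MFSystem.H₁])
        (by simp [MFSystem.Gvt]) (h.pos_H₁t k hk) (h.eq_Qt k hk) (h.eq_Ut k hk)⟩

/-- Symmetry is not part of the equations; it is inherited from semidefiniteness. -/
theorem isSymm (h : S.SolvesCoupled γ K P Q Pt Qt U Ut V Vt) {k : ℕ} (hk : k ≤ K + 1) :
    (P k).IsSymm ∧ (Q k).IsSymm := by
  have h1 := posSemidef_iff_real.1 (h.posSemidef_neg k hk).1
  have h2 := posSemidef_iff_real.1 (h.posSemidef_neg k hk).2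
  exact ⟨by simpa using h1.1.neg, by simpa using h2.1.neg⟩

theorem isSymm_tilde (h : S.SolvesCoupled γ K P Q Pt Qt U Ut V Vt) {k : ℕ} (hk : k ≤ K + 1) :
    (Pt k).IsSymm ∧ (Qt k).IsSymm :=
  ⟨(posSemidef_iff_real.1 (h.posSemidef_tilde k hk).1).1,
    (posSemidef_iff_real.1 (h.posSemidef_tilde k hk).2).1⟩

/-! ### Stage balances, cost identities and optimality. -/

variable {Ω : Type*} [MeasurableSpace Ω] {μ : Measure Ω} [IsProbabilityMeasure μ]
  {w : ℕ → Ω → ℝ} {x₀ : Fin n → ℝ}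

/-- The one-step balance of the disturbance-attenuation problem under `u*`. -/
theorem stage_attenuation (h : S.SolvesCoupled γ K P Q Pt Qt U Ut V Vt)
    (hΨ : ∀ k ≤ K, (S.Ψ k)ᵀ * S.Ψ k = 1) (hw : IsNoise μ K w) {d : Policy Ω n l}
    (hd : d.Admissible μ w K) {k : ℕ} (hk : k ≤ K) :
    γ ^ 2 * (∫ a, S.disturbance μ w x₀ (feedback μ U Ut) d k a
          ⬝ᵥ S.disturbance μ w x₀ (feedback μ U Ut) d k a ∂μ)
        - ∫ a, S.output μ w x₀ (feedback μ U Ut) d k a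
          ⬝ᵥ S.output μ w x₀ (feedback μ U Ut) d k a ∂μ
      = meanFieldForm μ (P k) (Q k) (S.state μ w x₀ (feedback μ U Ut) d k)
        - meanFieldForm μ (P (k + 1)) (Q (k + 1)) (S.state μ w x₀ (feedback μ U Ut) d (k + 1))
        + meanFieldForm μ (S.H γ k (P (k + 1))) (S.Ht γ k (P (k + 1)) (Q (k + 1)))
            (S.disturbance μ w x₀ (feedback μ U Ut) d k
              - feedback μ V Vt k (S.state μ w x₀ (feedback μ U Ut) d k)) := by
  have hc := admissible_feedback (μ := μ) (w := w) (K := K) U Ut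
  have hx := MFSystem.adaptedL2_state (S := S) (x₀ := x₀) hw hc hd k (by omega)
  have hv : AdaptedL2 μ w k (S.disturbance μ w x₀ (feedback μ U Ut) d k) := hd k hk _ hx
  have hs := h.isSymm (k := k + 1) (by omega)
  have hstep : S.state μ w x₀ (feedback μ U Ut) d (k + 1)
      = S.step μ w k (S.state μ w x₀ (feedback μ U Ut) d k)
          (feedback μ U Ut k (S.state μ w x₀ (feedback μ U Ut) d k))
          (S.disturbance μ w x₀ (feedback μ U Ut) d k) := rfl
  -- With `u*` in force, its energy is a quadratic form in the state and joins `Φᵀ Φ` in the state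
  -- weights.
  have key := meanField_stage hx.2 hv.2 (M := S.A k + S.F k * U k) (Mt := S.At k + S.F k * Ut k)
    (N := S.B k) (Nt := S.Bt k) (C := S.C k) (Ct := S.Ct k) (D := S.D k) (Dt := S.Dt k)
    (P₁ := P (k + 1)) (Q₁ := Q (k + 1)) (R := γ ^ 2 • (1 : Matrix (Fin l) (Fin l) ℝ))
    (W := -((S.Φ k)ᵀ * S.Φ k + (U k)ᵀ * U k))
    (Wt := -((S.Φ k)ᵀ * S.Φ k + (U k + Ut k)ᵀ * (U k + Ut k)))
    (X := P k) (Y := Q k) (L := V k) (Lt := Vt k) (H := S.H γ k (P (k + 1)))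
    (Ht := S.Ht γ k (P (k + 1)) (Q (k + 1)))
    (stage_completion hs.1 hs.1 rfl rfl (h.pos_H k hk) (by rw [h.eq_P k hk]; abel)
      (h.eq_V k hk))
    (by
      have e : S.A k + S.F k * U k + (S.At k + S.F k * Ut k)
          = S.A k + S.At k + S.F k * (U k + Ut k) := by
        rw [Matrix.mul_add]; abel
      rw [e]
      exact stage_completion hs.2 hs.1 rfl rfl (h.pos_Ht k hk) (by rw [h.eq_Q k hk]; abel)
        (h.eq_Vt k hk))
  rw [meanFieldForm_neg, meanFieldForm_add hx.2] at key
  rw [MFSystem.integral_output_sq hw hc hd hk (hΨ k hk), hstep, S.step_feedback_control,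
    hw.meanFieldForm_add_noise hk ((hx.meanFieldMap _ _).add (hv.meanFieldMap _ _))
      ((hx.meanFieldMap _ _).add (hv.meanFieldMap _ _))]
  have hu : ∫ a, S.control μ w x₀ (feedback μ U Ut) d k a
        ⬝ᵥ S.control μ w x₀ (feedback μ U Ut) d k a ∂μ
      = meanFieldForm μ ((U k)ᵀ * U k) ((U k + Ut k)ᵀ * (U k + Ut k))
          (S.state μ w x₀ (feedback μ U Ut) d k) :=
    integral_meanFieldMap_sq hx.2 (U k) (Ut k)
  have hR : secondMoment μ (γ ^ 2 • (1 : Matrix (Fin l) (Fin l) ℝ))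
        (S.disturbance μ w x₀ (feedback μ U Ut) d k)
      = γ ^ 2 * ∫ a, S.disturbance μ w x₀ (feedback μ U Ut) d k a
          ⬝ᵥ S.disturbance μ w x₀ (feedback μ U Ut) d k a ∂μ := by
    rw [← meanFieldForm_self hv.2, meanFieldForm_smul_one hv.2]
  rw [hu, feedback_apply]
  rw [hR] at key
  linarith

/-- The one-step balance of the output-energy problem when `ν*` is implemented. -/
theorem stage_energy (h : S.SolvesCoupled γ K P Q Pt Qt U Ut V Vt)
    (hΨ : ∀ k ≤ K, (S.Ψ k)ᵀ * S.Ψ k = 1) (hw : IsNoise μ K w) {c : Policy Ω n q}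
    (hc : c.Admissible μ w K) {k : ℕ} (hk : k ≤ K) :
    ∫ a, S.output μ w x₀ c (feedback μ V Vt) k a
          ⬝ᵥ S.output μ w x₀ c (feedback μ V Vt) k a ∂μ
      = meanFieldForm μ (Pt k) (Qt k) (S.state μ w x₀ c (feedback μ V Vt) k)
        - meanFieldForm μ (Pt (k + 1)) (Qt (k + 1)) (S.state μ w x₀ c (feedback μ V Vt) (k + 1))
        + meanFieldForm μ (S.H₁ k (Pt (k + 1))) (S.H₁ k (Qt (k + 1)))
            (S.control μ w x₀ c (feedback μ V Vt) k
              - feedback μ U Ut k (S.state μ w x₀ c (feedback μ V Vt) k)) := by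
  have hd := admissible_feedback (μ := μ) (w := w) (K := K) V Vt
  have hx := MFSystem.adaptedL2_state (S := S) (x₀ := x₀) hw hc hd k (by omega)
  have hu : AdaptedL2 μ w k (S.control μ w x₀ c (feedback μ V Vt) k) := hc k hk _ hx
  have hs := h.isSymm_tilde (k := k + 1) (by omega)
  have hstep : S.state μ w x₀ c (feedback μ V Vt) (k + 1)
      = S.step μ w k (S.state μ w x₀ c (feedback μ V Vt) k)
          (S.control μ w x₀ c (feedback μ V Vt) k)
          (feedback μ V Vt k (S.state μ w x₀ c (feedback μ V Vt) k)) := rfl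
  have key := meanField_stage hx.2 hu.2 (M := S.A k + S.B k * V k)
    (Mt := S.At k + S.B k * Vt k + S.Bt k * (V k + Vt k))
    (N := S.F k) (Nt := 0) (C := S.C k + S.D k * V k)
    (Ct := S.Ct k + S.D k * Vt k + S.Dt k * (V k + Vt k)) (D := 0) (Dt := 0)
    (P₁ := Pt (k + 1)) (Q₁ := Qt (k + 1)) (R := 1)
    (W := (S.Φ k)ᵀ * S.Φ k) (Wt := (S.Φ k)ᵀ * S.Φ k)
    (X := Pt k) (Y := Qt k) (L := U k) (Lt := Ut k)
    (stage_completion hs.1 hs.1 (by simp [MFSystem.H₁]) (by simp [MFSystem.Gv])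
      (h.pos_H₁ k hk) (h.eq_Pt k hk) (h.eq_U k hk))
    (by
      -- The mean coefficients were chosen so that these sums are the closed-loop matrices of the
      -- equation for `Qt`.
      have e : S.A k + S.B k * V k + (S.At k + S.B k * Vt k + S.Bt k * (V k + Vt k))
          = S.A k + S.At k + (S.B k + S.Bt k) * (V k + Vt k) := by
        simp only [Matrix.mul_add, Matrix.add_mul]; abel
      have e' : S.C k + S.D k * V k + (S.Ct k + S.D k * Vt k + S.Dt k * (V k + Vt k))
          = S.C k + S.Ct k + (S.D k + S.Dt k) * (V k + Vt k) := by
        simp only [Matrix.mul_add, Matrix.add_mul]; abel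
      rw [e, e', add_zero, add_zero]
      exact stage_completion hs.2 hs.1 (by simp [MFSystem.H₁]) (by simp [MFSystem.Gvt])
        (h.pos_H₁t k hk) (h.eq_Qt k hk) (h.eq_Ut k hk))
  rw [MFSystem.integral_output_sq hw hc hd hk (hΨ k hk), hstep,
    S.step_feedback_disturbance k (hx.2.integrable one_le_two),
    hw.meanFieldForm_add_noise hk ((hx.meanFieldMap _ _).add (hu.meanFieldMap _ _))
      ((hx.meanFieldMap _ _).add (hu.meanFieldMap _ _)), feedback_apply]
  rw [secondMoment_one] at key
  linarith

omit [IsProbabilityMeasure μ] in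
theorem attenuationGap_nonneg (h : S.SolvesCoupled γ K P Q Pt Qt U Ut V Vt) {d : Policy Ω n l}
    {k : ℕ} (hk : k ≤ K) : 0 ≤ S.attenuationGap μ w γ P Q U Ut V Vt x₀ d k :=
  meanFieldForm_nonneg (h.pos_H k hk).posSemidef (h.pos_Ht k hk).posSemidef _

/-- The stage balances telescope, the terminal form is zero, and a deterministic start leaves only
the `Q 0` term. Stating this for policies covers open-loop inputs and feedback at once. -/
theorem J₁_eq (h : S.SolvesCoupled γ K P Q Pt Qt U Ut V Vt)
    (hΨ : ∀ k ≤ K, (S.Ψ k)ᵀ * S.Ψ k = 1) (hw : IsNoise μ K w) {d : Policy Ω n l}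
    (hd : d.Admissible μ w K) :
    S.J₁ μ w K γ x₀ (feedback μ U Ut) d = meanFieldForm μ (P 0) (Q 0) (fun _ => x₀)
      + ∑ k ∈ Finset.range (K + 1), S.attenuationGap μ w γ P Q U Ut V Vt x₀ d k := by
  rw [MFSystem.J₁, energy, energy, Finset.mul_sum, ← Finset.sum_sub_distrib,
    Finset.sum_congr rfl fun k hk => h.stage_attenuation hΨ hw hd
      (Nat.lt_succ_iff.1 (Finset.mem_range.1 hk)), Finset.sum_add_distrib,
    Finset.sum_range_sub', h.final_P, h.final_Q]
  simp [meanFieldForm, secondMoment, MFSystem.attenuationGap, MFSystem.state]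

theorem J₂_eq (h : S.SolvesCoupled γ K P Q Pt Qt U Ut V Vt)
    (hΨ : ∀ k ≤ K, (S.Ψ k)ᵀ * S.Ψ k = 1) (hw : IsNoise μ K w) {c : Policy Ω n q}
    (hc : c.Admissible μ w K) :
    S.J₂ μ w K x₀ c (feedback μ V Vt) = meanFieldForm μ (Pt 0) (Qt 0) (fun _ => x₀)
      + ∑ k ∈ Finset.range (K + 1), meanFieldForm μ (S.H₁ k (Pt (k + 1))) (S.H₁ k (Qt (k + 1)))
            (S.control μ w x₀ c (feedback μ V Vt) k
              - feedback μ U Ut k (S.state μ w x₀ c (feedback μ V Vt) k)) := by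
  rw [MFSystem.J₂, energy,
    Finset.sum_congr rfl fun k hk => h.stage_energy hΨ hw hc
      (Nat.lt_succ_iff.1 (Finset.mem_range.1 hk)), Finset.sum_add_distrib,
    Finset.sum_range_sub', h.final_Pt, h.final_Qt]
  simp [meanFieldForm, secondMoment, MFSystem.state]

theorem J₁_le (h : S.SolvesCoupled γ K P Q Pt Qt U Ut V Vt)
    (hΨ : ∀ k ≤ K, (S.Ψ k)ᵀ * S.Ψ k = 1) (hw : IsNoise μ K w) {d : Policy Ω n l}
    (hd : d.Admissible μ w K) :
    S.J₁ μ w K γ x₀ (feedback μ U Ut) (feedback μ V Vt)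
      ≤ S.J₁ μ w K γ x₀ (feedback μ U Ut) d := by
  rw [h.J₁_eq hΨ hw (admissible_feedback V Vt), h.J₁_eq hΨ hw hd]
  gcongr with k hk
  -- Along its own trajectory `ν*` has zero residual.
  have h0 : S.attenuationGap μ w γ P Q U Ut V Vt x₀ (feedback μ V Vt) k = 0 := by
    simp only [MFSystem.attenuationGap, MFSystem.disturbance, sub_self, meanFieldForm_zero]
  rw [h0]
  exact h.attenuationGap_nonneg (Nat.lt_succ_iff.1 (Finset.mem_range.1 hk))

theorem J₂_le (h : S.SolvesCoupled γ K P Q Pt Qt U Ut V Vt)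
    (hΨ : ∀ k ≤ K, (S.Ψ k)ᵀ * S.Ψ k = 1) (hw : IsNoise μ K w) {c : Policy Ω n q}
    (hc : c.Admissible μ w K) :
    S.J₂ μ w K x₀ (feedback μ U Ut) (feedback μ V Vt)
      ≤ S.J₂ μ w K x₀ c (feedback μ V Vt) := by
  rw [h.J₂_eq hΨ hw (admissible_feedback U Ut), h.J₂_eq hΨ hw hc]
  gcongr with k hk
  have hk' := Nat.lt_succ_iff.1 (Finset.mem_range.1 hk)
  simp only [MFSystem.control, sub_self, meanFieldForm_zero]
  exact meanFieldForm_nonneg (h.pos_H₁ k hk').posSemidef (h.pos_H₁t k hk').posSemidef _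

/-! ### Coercivity and strict attenuation. -/

theorem exists_disturbance_bound (h : S.SolvesCoupled γ K P Q Pt Qt U Ut V Vt)
    (hw : IsNoise μ K w) {k : ℕ} (hk : k ≤ K) :
    ∃ a b : ℝ, 0 ≤ a ∧ 0 ≤ b ∧ ∀ (x₀ : Fin n → ℝ) (d : Policy Ω n l), d.Admissible μ w K →
      ∫ t, S.disturbance μ w x₀ (feedback μ U Ut) d k t
          ⬝ᵥ S.disturbance μ w x₀ (feedback μ U Ut) d k t ∂μ
        ≤ a * (∫ t, S.state μ w x₀ (feedback μ U Ut) d k t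
            ⬝ᵥ S.state μ w x₀ (feedback μ U Ut) d k t ∂μ)
          + b * S.attenuationGap μ w γ P Q U Ut V Vt x₀ d k := by
  obtain ⟨a, ha0, ha⟩ := exists_meanFieldMap_bound μ (V k) (Vt k)
  obtain ⟨b, hb0, hb⟩ := exists_meanFieldForm_lower_bound μ (h.pos_H k hk) (h.pos_Ht k hk)
  refine ⟨2 * a, 2 * b, by positivity, by positivity, fun x₀ d hd => ?_⟩
  have hx := (MFSystem.adaptedL2_state (S := S) (x₀ := x₀) hw
    (admissible_feedback (μ := μ) (w := w) (K := K) U Ut) hd k (by omega))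
  have hv : AdaptedL2 μ w k (S.disturbance μ w x₀ (feedback μ U Ut) d k) := hd k hk _ hx
  have hf := memLp_meanFieldMap hx.2 (V k) (Vt k)
  -- Write `ν = ν*(x) + (ν - ν*(x))`: the state controls the first part and the gap controls the
  -- second.
  have h1 := integral_add_sq_le hf (hv.2.sub hf)
  rw [add_sub_cancel] at h1
  have h2 := ha _ hx.2
  have h3 := hb _ (hv.2.sub hf)
  simp only [MFSystem.attenuationGap, feedback_apply]
  linarith

/-- A discrete Grönwall argument: with zero initial state, the residuals before time `k` generate
`x(k)`. The constant depends on `k` but not on `d`. -/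
theorem exists_state_bound (h : S.SolvesCoupled γ K P Q Pt Qt U Ut V Vt)
    (hw : IsNoise μ K w) : ∀ k ≤ K,
    ∃ a : ℝ, 0 ≤ a ∧ ∀ d : Policy Ω n l, d.Admissible μ w K →
      ∫ t, S.state μ w 0 (feedback μ U Ut) d k t ⬝ᵥ S.state μ w 0 (feedback μ U Ut) d k t ∂μ
        ≤ a * ∑ j ∈ Finset.range k, S.attenuationGap μ w γ P Q U Ut V Vt 0 d j := by
  intro k
  induction k with
  | zero => exact fun _ => ⟨0, le_rfl, fun d _ => by simp [MFSystem.state]⟩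
  | succ k ih =>
    intro hk
    have hk' : k ≤ K := by omega
    obtain ⟨a, ha0, ha⟩ := ih hk'
    obtain ⟨b, c, hb0, hc0, hbc⟩ := h.exists_disturbance_bound hw hk'
    obtain ⟨a₁, ha₁0, ha₁⟩ :=
      exists_meanFieldMap_bound μ (S.A k + S.F k * U k) (S.At k + S.F k * Ut k)
    obtain ⟨a₂, ha₂0, ha₂⟩ := exists_meanFieldMap_bound μ (S.B k) (S.Bt k)
    obtain ⟨a₃, ha₃0, ha₃⟩ := exists_meanFieldMap_bound μ (S.C k) (S.Ct k)
    obtain ⟨a₄, ha₄0, ha₄⟩ := exists_meanFieldMap_bound μ (S.D k) (S.Dt k)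
    refine ⟨2 * (a₁ + a₃) * a + 2 * (a₂ + a₄) * (b * a + c), by positivity, fun d hd => ?_⟩
    have hx := (MFSystem.adaptedL2_state (S := S) (x₀ := 0) hw
      (admissible_feedback (μ := μ) (w := w) (K := K) U Ut) hd k (by omega))
    have hx' := (MFSystem.adaptedL2_state (S := S) (x₀ := 0) hw
      (admissible_feedback (μ := μ) (w := w) (K := K) U Ut) hd (k + 1) (by omega))
    have hv : AdaptedL2 μ w k (S.disturbance μ w 0 (feedback μ U Ut) d k) := hd k hk' _ hx
    have hstep : S.state μ w 0 (feedback μ U Ut) d (k + 1)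
      = S.step μ w k (S.state μ w 0 (feedback μ U Ut) d k)
          (feedback μ U Ut k (S.state μ w 0 (feedback μ U Ut) d k))
          (S.disturbance μ w 0 (feedback μ U Ut) d k) := rfl
    have hdr := (hx.meanFieldMap (S.A k + S.F k * U k) (S.At k + S.F k * Ut k)).add
      (hv.meanFieldMap (S.B k) (S.Bt k))
    have hdi := (hx.meanFieldMap (S.C k) (S.Ct k)).add (hv.meanFieldMap (S.D k) (S.Dt k))
    have e1 := integral_add_sq_le
      (hx.meanFieldMap (S.A k + S.F k * U k) (S.At k + S.F k * Ut k)).2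
      (hv.meanFieldMap (S.B k) (S.Bt k)).2
    have e2 := integral_add_sq_le (hx.meanFieldMap (S.C k) (S.Ct k)).2
      (hv.meanFieldMap (S.D k) (S.Dt k)).2
    have e3 := ha₁ _ hx.2
    have e4 := ha₂ _ hv.2
    have e5 := ha₃ _ hx.2
    have e6 := ha₄ _ hv.2
    have e7 := hbc 0 d hd
    have e8 := ha d hd
    have g0 : 0 ≤ S.attenuationGap μ w γ P Q U Ut V Vt 0 d k := h.attenuationGap_nonneg hk'
    have s0 : 0 ≤ ∑ j ∈ Finset.range k, S.attenuationGap μ w γ P Q U Ut V Vt 0 d j :=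
      Finset.sum_nonneg fun j hj =>
        h.attenuationGap_nonneg ((Finset.mem_range.1 hj).le.trans hk')
    have step : ∫ t, S.state μ w 0 (feedback μ U Ut) d (k + 1) t
          ⬝ᵥ S.state μ w 0 (feedback μ U Ut) d (k + 1) t ∂μ
        ≤ 2 * (a₁ + a₃) * (∫ t, S.state μ w 0 (feedback μ U Ut) d k t
            ⬝ᵥ S.state μ w 0 (feedback μ U Ut) d k t ∂μ)
          + 2 * (a₂ + a₄) * (∫ t, S.disturbance μ w 0 (feedback μ U Ut) d k t
            ⬝ᵥ S.disturbance μ w 0 (feedback μ U Ut) d k t ∂μ) := by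
      rw [← secondMoment_one, ← meanFieldForm_self hx'.2, hstep, S.step_feedback_control,
        hw.meanFieldForm_add_noise hk' hdr hdi, meanFieldForm_self hdr.2,
        meanFieldForm_self hdi.2, secondMoment_one, secondMoment_one]
      linarith
    rw [Finset.sum_range_succ]
    generalize (∑ j ∈ Finset.range k, S.attenuationGap μ w γ P Q U Ut V Vt 0 d j) = s at *
    generalize S.attenuationGap μ w γ P Q U Ut V Vt 0 d k = g at *
    refine step.trans ?_
    have r1 : (∫ t, S.disturbance μ w 0 (feedback μ U Ut) d k t
            ⬝ᵥ S.disturbance μ w 0 (feedback μ U Ut) d k t ∂μ) ≤ (b * a + c) * (s + g) := by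
      have p1 := mul_le_mul_of_nonneg_left e8 hb0
      have p2 : 0 ≤ b * a * g := by positivity
      have p3 : 0 ≤ c * s := by positivity
      linarith
    have r2 : (∫ t, S.state μ w 0 (feedback μ U Ut) d k t
            ⬝ᵥ S.state μ w 0 (feedback μ U Ut) d k t ∂μ) ≤ a * (s + g) := by
      have p2 : 0 ≤ a * g := by positivity
      linarith
    have r3 := mul_le_mul_of_nonneg_left r1 (by positivity : 0 ≤ 2 * (a₂ + a₄))
    have r4 := mul_le_mul_of_nonneg_left r2 (by positivity : 0 ≤ 2 * (a₁ + a₃))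
    linarith

theorem exists_energy_bound (h : S.SolvesCoupled γ K P Q Pt Qt U Ut V Vt)
    (hw : IsNoise μ K w) :
    ∃ M : ℝ, 0 < M ∧ ∀ d : Policy Ω n l, d.Admissible μ w K →
      energy μ K (S.disturbance μ w 0 (feedback μ U Ut) d)
        ≤ M * ∑ j ∈ Finset.range (K + 1), S.attenuationGap μ w γ P Q U Ut V Vt 0 d j := by
  -- Keeping `k ≤ K` inside the existential lets the constants be chosen as a function on all of
  -- `ℕ`, with `0` beyond the horizon.
  have hb : ∀ k : ℕ, ∃ a : ℝ, 0 ≤ a ∧ (k ≤ K → ∀ d : Policy Ω n l, d.Admissible μ w K →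
      ∫ t, S.disturbance μ w 0 (feedback μ U Ut) d k t
          ⬝ᵥ S.disturbance μ w 0 (feedback μ U Ut) d k t ∂μ
        ≤ a * ∑ j ∈ Finset.range (K + 1), S.attenuationGap μ w γ P Q U Ut V Vt 0 d j) := by
    intro k
    by_cases hk : k ≤ K
    · obtain ⟨a, ha0, ha⟩ := h.exists_state_bound hw k hk
      obtain ⟨b, c, hb0, hc0, hbc⟩ := h.exists_disturbance_bound hw hk
      refine ⟨b * a + c, by positivity, fun _ d hd => ?_⟩
      have hg : ∀ j ∈ Finset.range (K + 1),
          0 ≤ S.attenuationGap μ w γ P Q U Ut V Vt 0 d j := fun j hj =>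
        h.attenuationGap_nonneg (Nat.lt_succ_iff.1 (Finset.mem_range.1 hj))
      have e1 : ∑ j ∈ Finset.range k, S.attenuationGap μ w γ P Q U Ut V Vt 0 d j
          ≤ ∑ j ∈ Finset.range (K + 1), S.attenuationGap μ w γ P Q U Ut V Vt 0 d j :=
        Finset.sum_le_sum_of_subset_of_nonneg (Finset.range_subset_range.2 (by omega))
          fun j hj _ => hg j hj
      have e2 := Finset.single_le_sum hg (Finset.mem_range.2 (Nat.lt_succ_iff.2 hk))
      have e3 := mul_le_mul_of_nonneg_left ((ha d hd).trans (mul_le_mul_of_nonneg_left e1 ha0)) hb0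
      have e4 := mul_le_mul_of_nonneg_left e2 hc0
      have e5 := hbc 0 d hd
      linarith
    · exact ⟨0, le_rfl, fun h' => absurd h' hk⟩
  choose a ha0 ha using hb
  -- The `1 +` keeps the constant positive, so that it can be inverted later.
  refine ⟨1 + ∑ k ∈ Finset.range (K + 1), a k,
    add_pos_of_pos_of_nonneg one_pos (Finset.sum_nonneg fun k _ => ha0 k), fun d hd => ?_⟩
  have hg : 0 ≤ ∑ j ∈ Finset.range (K + 1), S.attenuationGap μ w γ P Q U Ut V Vt 0 d j :=
    Finset.sum_nonneg fun j hj =>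
      h.attenuationGap_nonneg (Nat.lt_succ_iff.1 (Finset.mem_range.1 hj))
  rw [add_mul, one_mul, Finset.sum_mul]
  exact (Finset.sum_le_sum fun k hk =>
    ha k (Nat.lt_succ_iff.1 (Finset.mem_range.1 hk)) d hd).trans (le_add_of_nonneg_left hg)

theorem normL_lt (h : S.SolvesCoupled γ K P Q Pt Qt U Ut V Vt) (hγ : 0 < γ)
    (hΨ : ∀ k ≤ K, (S.Ψ k)ᵀ * S.Ψ k = 1) (hw : IsNoise μ K w) :
    S.normL μ w K (feedback μ U Ut) < ENNReal.ofReal γ := by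
  obtain ⟨M, hM0, hM⟩ := h.exists_energy_bound hw
  -- One bound below `γ` serves for every `ν`, so the supremum stays strictly below. If `γ ^ 2 -
  -- M⁻¹` is negative, its square root is `0` and the inequality still holds.
  have hlt : √(γ ^ 2 - M⁻¹) < γ := by
    rw [Real.sqrt_lt' hγ]
    linarith [inv_pos.2 hM0]
  refine lt_of_le_of_lt (iSup₂_le fun ν hν => ENNReal.ofReal_le_ofReal ?_)
    ((ENNReal.ofReal_lt_ofReal_iff hγ).2 hlt)
  have hd : Policy.Admissible (n := n) μ w K (openLoop ν) := admissible_openLoop hν.1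
  have hpos : 0 < energy μ K ν := lt_of_le_of_ne
    (Finset.sum_nonneg fun k _ => integral_nonneg fun a => dotProduct_self_nonneg_real _)
    (Ne.symm hν.2)
  have hJ := h.J₁_eq (x₀ := 0) hΨ hw hd
  have hE : energy μ K ν ≤ _ := hM _ hd
  have hz : meanFieldForm μ (P 0) (Q 0) (fun _ : Ω => (0 : Fin n → ℝ)) = 0 :=
    meanFieldForm_zero _ _
  have hJ' : S.J₁ μ w K γ 0 (feedback μ U Ut) (openLoop ν) = γ ^ 2 * energy μ K ν
      - energy μ K (S.output μ w 0 (feedback μ U Ut) (openLoop ν)) := rfl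
  rw [hz, zero_add, hJ'] at hJ
  -- For `x₀ = 0` the sum of gaps is `J₁` itself, so coercivity reads `M⁻¹ ‖ν‖² ≤ γ² ‖ν‖² - ‖z‖²`.
  rw [← hJ, ← inv_mul_le_iff₀ hM0] at hE
  rw [← Real.sqrt_div' _ hpos.le]
  refine Real.sqrt_le_sqrt ?_
  rw [div_le_iff₀ hpos]
  linarith

end MFSystem.SolvesCoupled

end Coupled

theorem theorem4p2 {Ω : Type*} [MeasurableSpace Ω] (μ : Measure Ω) [IsProbabilityMeasure μ]
    {n l q m₁ m₂ : ℕ} (S : MFSystem n l q m₁ m₂) (K : ℕ) (γ : ℝ) (hγ : 0 < γ)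
    (hΨ : ∀ k ≤ K, (S.Ψ k)ᵀ * S.Ψ k = 1)
    (w : ℕ → Ω → ℝ) (hw : IsNoise μ K w)
    (P Q Pt Qt : ℕ → Matrix (Fin n) (Fin n) ℝ)
    (U Ut : ℕ → Matrix (Fin q) (Fin n) ℝ) (V Vt : ℕ → Matrix (Fin l) (Fin n) ℝ)
    (hsol : S.SolvesCoupled γ K P Q Pt Qt U Ut V Vt) :
    S.SolvesH2Hinf μ w K γ U Ut V Vt ∧
      (∀ k ≤ K, (-Q k).PosSemidef) ∧ (∀ k ≤ K, (Qt k).PosSemidef) := by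
  refine ⟨⟨fun x₀ ν hν => ?_, fun x₀ u hu => ?_, fun x₀ => ?_, hsol.normL_lt hγ hΨ hw,
    fun x₀ ν hν => hsol.J₁_le hΨ hw (admissible_openLoop hν),
    fun x₀ u hu => hsol.J₂_le hΨ hw (admissible_openLoop hu)⟩,
    fun k hk => (hsol.posSemidef_neg k (by omega)).2,
    fun k hk => (hsol.posSemidef_tilde k (by omega)).2⟩
  · obtain ⟨hx, hu, -, hz⟩ := MFSystem.memL2w_signals (S := S) (x₀ := x₀) hw
      (admissible_feedback U Ut) (admissible_openLoop hν)
    exact ⟨hx, hu, hz⟩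
  · obtain ⟨hx, -, hv, hz⟩ := MFSystem.memL2w_signals (S := S) (x₀ := x₀) hw
      (admissible_openLoop hu) (admissible_feedback V Vt)
    exact ⟨hx, hv, hz⟩
  · exact MFSystem.memL2w_signals hw (admissible_feedback U Ut) (admissible_feedback V Vt)
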